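/- Let $k$ be a field. \textbf{CPS highest weight categories.} Let $\mathbf{A}$ be a $k$-linear abelian category which is locally artinian (directed unions of subobjects exist and every object is the union of its subobjects of finite length), has enough injectives, and satisfies $B\cap\bigcup_i Y_i=\bigcup_i(B\cap Y_i)$ for directed families of subobjects. Let $L(\lambda)$, $\lambda\in\Lambda$, be representatives of the isomorphism classes of simple objects of $\mathbf{A}$. A \emph{highest weight structure in the sense of Cline--Parshall--Scott (CPS)} on $\mathbf{A}$ consists of an interval finite partial order $\sqsubseteq$ on $\Lambda$, objects $A(\lambda)$ with monomorphisms $L(\lambda)\hookrightarrow A(\lambda)$ such that all composition factors $L(\mu)$ of $A(\lambda)/L(\lambda)$ satisfy $\mu\sqsubset\lambda$, with all $\dim_k\mathrm{Hom}(A(\lambda),A(\mu))$ and $[A(\lambda):L(\mu)]$ finite, and, for each $\lambda$, an injective hull $I(\lambda)$ of $L(\lambda)$ in $\mathbf{A}$ with a good filtration $0=F_0\subseteq F_1\subseteq F_2\subseteq\cdots$ (finite or infinite) with $\bigcup_n F_n=I(\lambda)$, $F_1\simeq A(\lambda)$, and each $F_{n+1}/F_n$, $n\ge 1$, isomorphic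 to some $A(\mu)$ with $\mu\sqsupset\lambda$, each $\mu$ occurring for only finitely many $n$. \textbf{Part I.} Let $(\mathbf{A},\sqsubseteq)$ be a CPS highest weight category, and fix $\lambda\in\Lambda$ with $\dim_k\mathrm{Ext}^1_{\mathbf{A}}(L(\lambda),L(\mu))=\dim_k\mathrm{Ext}^1_{\mathbf{A}}(L(\mu),L(\lambda))$ for all $\mu\in\Lambda$. (1) If $\mathrm{Ext}^2_{\mathbf{A}}(L(\lambda),L(\lambda))=0$, then $L(\lambda)=A(\lambda)$. (2) If $A(\lambda)=L(\lambda)$, then, for all $\nu\in\Lambda$, $A(\lambda)$ appears as a section of a good filtration of $I(\nu)$ if and only if $\nu=\lambda$. \textbf{Lower finite highest weight categories.} Assume now that $k$ is algebraically closed. Let $\mathbf{C}$ be an essentially small $k$-linear abelian category in which all objects have finite length and all morphism spaces are finite dimensional, with simple objects $L(\lambda)$, $\lambda\in\Lambda$, up to isomorphism. For $\Omega\subset\Lambda$ let $\mathbf{C}_\Omega$ be the Serre subcategory of objects with all composition factors $L(\mu)$, $\mu\in\Omega$, and for $X\in\mathrm{Ind}\,\mathbf{C}$ let $\Gamma_\Omega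 X$ be the largest subobject of $X$ all of whose composition factors are labelled by $\Omega$. Let $I(\lambda)$ be the injective hull of $L(\lambda)$ in $\mathrm{Ind}\,\mathbf{C}$. For a partial order $\le$ on $\Lambda$ such that every set $\{\mu\mid\mu\le\lambda\}$ is finite, $(\mathbf{C},\le)$ is a \emph{lower finite highest weight (lfhw) category} if for each $\lambda$: (i) $\mathbf{C}_{\le\lambda}$ has an object $G$ such that every object of $\mathbf{C}_{\le\lambda}$ is a subquotient of some $G^{n}$; (ii) $\nabla(\lambda):=\Gamma_{\le\lambda}I(\lambda)$ lies in $\mathbf{C}$ and $[\nabla(\lambda):L(\lambda)]=1$; (iii) $I(\lambda)$ is the union of a directed set of subobjects, each having a finite filtration with all quotients of the form $\nabla(\mu)$, $\mu\ge\lambda$. \textbf{Part II.} Let $(\mathbf{C},\le)$ be a lfhw category which admits an equivalence $\Psi:\mathbf{C}^{\mathrm{op}}\to\mathbf{C}$ with $\Psi(L)\simeq L$ for every simple object $L$. Suppose that $\sqsubseteq$ is any partial order on $\Lambda$ for which $\mathrm{Ind}\,\mathbf{C}$ carries a CPS highest weight structure, with costandard objects $A(\lambda)$. Then $A(\lambda)\simeq\nabla(\lambda)$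 for all $\lambda\in\Lambda$; more precisely, the first step $F_1\simeq A(\lambda)$ of the good filtration of $I(\lambda)$ is equal to $\Gamma_{\le\lambda}I(\lambda)$. Thus the costandard objects of every CPS highest weight structure on $\mathrm{Ind}\,\mathbf{C}$ are those of the lfhw structure of $\mathbf{C}$. -/

import Mathlib

open CategoryTheory CategoryTheory.Limits

universe t w v u w' v' u' x y

noncomputable section

namespace HW

/-! ### General notions in abelian categories -/

section Abelian

variable {A : Type u} [Category.{v} A] [Abelian A] {Λ : Type x}

/-- An object of finite length: both chain conditions hold for its subobjects. -/
def FiniteLength (X : A) : Prop :=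
  IsArtinianObject X ∧ IsNoetherianObject X

/-- The quotient `Z / Y` of two nested subobjects `Y ≤ Z` of `X`. -/
def subquotient {X : A} {Y Z : Subobject X} (h : Y ≤ Z) : A :=
  cokernel (Subobject.ofLE Y Z h)

/-- `S` is a subquotient of `X`. For simple `S` this says that `S` is a composition factor of `X`
(also when `X` has infinite length). -/
def IsFactor (S X : A) : Prop :=
  ∃ (Y : A) (i : Y ⟶ X) (p : Y ⟶ S), Mono i ∧ Epi p

/-- The multiplicity `[X : S]` of a simple object `S` in `X`: the supremum, over all finite chains
of subobjects of `X`, of the number of successive quotients isomorphic to `S`. -/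
def multiplicity (X S : A) : ℕ∞ :=
  ⨆ s : LTSeries (Subobject X), Set.encard {j : Fin s.length |
    Nonempty (subquotient (s.monotone (Fin.castSucc_le_succ j)) ≅ S)}

/-- `L` labels the isomorphism classes of simple objects of `A`. -/
structure LabelsSimples (L : Λ → A) : Prop where
  simple : ∀ a, Simple (L a)
  eq_of_iso : ∀ a b, Nonempty (L a ≅ L b) → a = b
  exists_iso : ∀ S : A, Simple S → ∃ a, Nonempty (S ≅ L a)

/-- `i : S ⟶ I` is an injective hull: `I` is injective and `i` is an essential monomorphism. -/
structure IsInjectiveHull {S I : A} (i : S ⟶ I) : Prop where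
  mono : Mono i
  injective : Injective I
  essential : ∀ {Z : A} (g : I ⟶ Z), Mono (i ≫ g) → Mono g

/-- All the composition factors of `X` are of the form `L a` with `a ∈ Ω`; these objects form the
Serre subcategory attached to `Ω`. -/
def FactorsIn (L : Λ → A) (Ω : Set Λ) (X : A) : Prop :=
  ∀ a, IsFactor (L a) X → a ∈ Ω

/-- `N = Γ_Ω X`, the largest subobject of `X` with all composition factors labelled by `Ω`. -/
def IsGamma (L : Λ → A) (Ω : Set Λ) {X : A} (N : Subobject X) : Prop :=
  IsGreatest {Y : Subobject X | FactorsIn L Ω (Y : A)} N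

/-! ### Highest weight categories in the sense of Cline, Parshall and Scott -/

variable (A) in
/-- Standing assumptions on the underlying abelian category: it is locally artinian (directed
unions of subobjects exist, and each object is the union of its subobjects of finite length),
it has enough injectives, and `B ∩ ⋃ Yᵢ = ⋃ (B ∩ Yᵢ)` for directed families of subobjects. -/
structure LocallyArtinian : Prop where
  exists_union : ∀ (X : A) (𝒮 : Set (Subobject X)), DirectedOn (· ≤ ·) 𝒮 → ∃ U, IsLUB 𝒮 U
  union_finiteLength : ∀ X : A, IsLUB {Y : Subobject X | FiniteLength (Y : A)} ⊤
  enoughInjectives : EnoughInjectives A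
  inf_union : ∀ (X : A) (𝒮 : Set (Subobject X)) (U B : Subobject X),
    DirectedOn (· ≤ ·) 𝒮 → IsLUB 𝒮 U → IsLUB ((fun Y => B ⊓ Y) '' 𝒮) (B ⊓ U)

/-- The `n`-th section `F (n + 1) / F n` of a filtration. -/
def gr {X : A} (F : ℕ →o Subobject X) (n : ℕ) : A :=
  subquotient (F.monotone (Nat.le_succ n))

/-- A good filtration `0 = F 0 ⊆ F 1 ⊆ ⋯` of `I` (the injective hull of the simple object with
label `a`): `F 1 ≅ ∇ a`, the higher sections are of the form `∇ b` with `a < b`, each `b` occurs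
finitely often, and `⋃ F n = I`. Steps with `F (n + 1) = F n` are allowed, so that finite
filtrations are covered as well. -/
structure IsGoodFiltration (P : PartialOrder Λ) (cost : Λ → A) (a : Λ) {I : A}
    (F : ℕ →o Subobject I) : Prop where
  zero : F 0 = ⊥
  one : Nonempty ((F 1 : A) ≅ cost a)
  step : ∀ n, 1 ≤ n → F (n + 1) = F n ∨ ∃ b, P.lt a b ∧ Nonempty (gr F n ≅ cost b)
  finite : ∀ b, {n | Nonempty (gr F n ≅ cost b)}.Finite
  union : IsLUB (Set.range F) ⊤

/-- The structure of a highest weight category in the sense of Cline, Parshall and Scott on a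
`k`-linear abelian category `A`, with simple objects `L a` and the order `P` on the labels. -/
structure CPSHighestWeight (k : Type t) [Field k] [Linear k A] (L : Λ → A)
    (P : PartialOrder Λ) where
  locallyArtinian : LocallyArtinian A
  labels : LabelsSimples L
  interval_finite : ∀ a b, {c | P.le a c ∧ P.le c b}.Finite
  /-- the costandard objects -/
  cost : Λ → A
  /-- the embedding of the simple object in the costandard object -/
  emb : ∀ a, L a ⟶ cost a
  emb_mono : ∀ a, Mono (emb a)
  lt_of_factor : ∀ a b, IsFactor (L b) (cokernel (emb a)) → P.lt b a
  finite_hom : ∀ a b, Module.Finite k (cost a ⟶ cost b)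
  finite_mult : ∀ a b, multiplicity (cost a) (L b) ≠ ⊤
  /-- the injective hulls of the simple objects -/
  hull : Λ → A
  /-- the embedding of the simple object in its injective hull -/
  hullEmb : ∀ a, L a ⟶ hull a
  isHull : ∀ a, IsInjectiveHull (hullEmb a)
  /-- the good filtrations of the injective hulls -/
  filt : ∀ a, ℕ →o Subobject (hull a)
  good : ∀ a, IsGoodFiltration P cost a (filt a)

end Abelian

/-! ### Ind-completions -/

section SmallModel

variable (C : Type u) [Category.{v} C] [EssentiallySmall.{w} C]

instance smallModelPreadditive [Preadditive C] : Preadditive (SmallModel.{w} C) :=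
  .ofFullyFaithful (equivSmallModel.{w} C).fullyFaithfulInverse

instance smallModelAbelian [Abelian C] : Abelian (SmallModel.{w} C) :=
  haveI : HasFiniteProducts (SmallModel.{w} C) :=
    ⟨fun _ => Adjunction.hasLimitsOfShape_of_equivalence (equivSmallModel.{w} C).inverse⟩
  haveI : (equivSmallModel.{w} C).inverse.Additive :=
    (equivSmallModel.{w} C).symm.fullyFaithfulFunctor.additive_ofFullyFaithful
  abelianOfEquivalence (equivSmallModel.{w} C).inverse

lemma smallModelInverse_additive [Abelian C] : (equivSmallModel.{w} C).inverse.Additive :=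
  (equivSmallModel.{w} C).symm.fullyFaithfulFunctor.additive_ofFullyFaithful

/-- Scalars act on morphisms of the small model through the equivalence with `C`. -/
instance smallModelSMul (k : Type t) [Field k] [Abelian C] [Linear k C]
    (X Y : SmallModel.{w} C) : SMul k (X ⟶ Y) where
  smul r f := (equivSmallModel.{w} C).fullyFaithfulInverse.preimage
    (r • (equivSmallModel.{w} C).inverse.map f)

lemma smallModelInverse_map_smul (k : Type t) [Field k] [Abelian C] [Linear k C]
    {X Y : SmallModel.{w} C} (r : k) (f : X ⟶ Y) :
    (equivSmallModel.{w} C).inverse.map (r • f) = r • (equivSmallModel.{w} C).inverse.map f :=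
  (equivSmallModel.{w} C).fullyFaithfulInverse.map_preimage _

instance smallModelModule (k : Type t) [Field k] [Abelian C] [Linear k C]
    (X Y : SmallModel.{w} C) : Module k (X ⟶ Y) :=
  haveI := smallModelInverse_additive.{w} C
  Function.Injective.module k (equivSmallModel.{w} C).inverse.mapAddHom
    (equivSmallModel.{w} C).inverse.map_injective
    (fun r f => smallModelInverse_map_smul C k r f)

instance smallModelLinear (k : Type t) [Field k] [Abelian C] [Linear k C] :
    Linear k (SmallModel.{w} C) where
  homModule X Y := smallModelModule C k X Y
  smul_comp X Y Z r f g := by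
    apply (equivSmallModel.{w} C).inverse.map_injective
    rw [Functor.map_comp, smallModelInverse_map_smul, smallModelInverse_map_smul,
      Functor.map_comp, Linear.smul_comp]
  comp_smul X Y Z f r g := by
    apply (equivSmallModel.{w} C).inverse.map_injective
    rw [Functor.map_comp, smallModelInverse_map_smul, smallModelInverse_map_smul,
      Functor.map_comp, Linear.comp_smul]

end SmallModel

section IndLinear

lemma ind_hom_ext {C : Type w} [SmallCategory C] {X Y : Ind C} (g h : X ⟶ Y)
    (H : ∀ (T : C) (f : Ind.yoneda.obj T ⟶ X), f ≫ g = f ≫ h) : g = h := by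
  apply Ind.isSeparating_range_yoneda
  rintro _ ⟨T⟩ f
  exact H T f

variable {k : Type t} [Field k] {C : Type w} [SmallCategory C] [Abelian C] [Linear k C]

instance indYoneda_additive : (Ind.yoneda : C ⥤ Ind C).Additive :=
  haveI : PreservesFiniteLimits (Ind.yoneda : C ⥤ Ind C) := inferInstance
  Functor.additive_of_preserves_binary_products _

/-- The action of a scalar on an ind-object, induced by its action on the objects of `C`. -/
def indScalar (r : k) (X : Ind C) : X ⟶ X :=
  (Ind.inclusion C).preimage
    { app := fun T => ((Ind.inclusion C).obj X).map (r • 𝟙 T.unop).op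
      naturality := by
        intro T T' f
        rw [← Functor.map_comp, ← Functor.map_comp]
        congr 1
        apply Quiver.Hom.unop_inj
        simp }

lemma indScalar_naturality (r : k) {X Y : Ind C} (f : X ⟶ Y) :
    f ≫ indScalar r Y = indScalar r X ≫ f := by
  apply (Ind.inclusion C).map_injective
  ext T : 2
  simp [indScalar]

lemma indScalar_yoneda (r : k) (T : C) :
    indScalar r (Ind.yoneda.obj T) = Ind.yoneda.map (r • 𝟙 T) := by
  apply (Ind.inclusion C).map_injective
  have h : (Ind.inclusion C).map (Ind.yoneda.map (r • 𝟙 T)) =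
      Ind.yonedaCompInclusion.hom.app T ≫ yoneda.map (r • 𝟙 T) ≫
        Ind.yonedaCompInclusion.inv.app T := by
    have := (Ind.yonedaCompInclusion (C := C)).hom.naturality (r • 𝟙 T)
    rw [← Category.assoc, ← this]
    simp
  rw [h, ← cancel_mono (Ind.yonedaCompInclusion.hom.app T)]
  simp only [Category.assoc, Iso.inv_hom_id_app, Category.comp_id]
  ext S y
  have h2 := congr_arg (fun φ => φ y) ((Ind.yonedaCompInclusion.hom.app T).naturality
    (r • 𝟙 S.unop).op)
  simp [indScalar] at h2 ⊢

lemma comp_indScalar (r : k) {T : C} {X : Ind C} (f : Ind.yoneda.obj T ⟶ X) :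
    f ≫ indScalar r X = Ind.yoneda.map (r • 𝟙 T) ≫ f := by
  rw [indScalar_naturality, indScalar_yoneda]

/-- The ring morphism from `k` to the center of the ind-completion. -/
def indCenter : k →+* CatCenter (Ind C) where
  toFun r :=
    { app := fun X => indScalar r X
      naturality := fun _ _ f => indScalar_naturality r f }
  map_one' := by
    ext X
    refine ind_hom_ext _ _ fun T f => ?_
    change f ≫ indScalar 1 X = f ≫ 𝟙 X
    simp [comp_indScalar]
  map_mul' r s := by
    ext X
    refine ind_hom_ext _ _ fun T f => ?_
    rw [CatCenter.mul_app']
    change f ≫ indScalar (r * s) X = f ≫ indScalar s X ≫ indScalar r X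
    rw [← indScalar_naturality, ← Category.assoc]
    simp only [comp_indScalar, Category.assoc]
    rw [← Category.assoc, ← Functor.map_comp]
    simp [mul_comm r s, mul_smul]
  map_zero' := by
    ext X
    refine ind_hom_ext _ _ fun T f => ?_
    change f ≫ indScalar 0 X = f ≫ 0
    simp [comp_indScalar]
  map_add' r s := by
    ext X
    refine ind_hom_ext _ _ fun T f => ?_
    change f ≫ indScalar (r + s) X = f ≫ (indScalar r X + indScalar s X)
    simp [comp_indScalar, add_smul, Functor.map_add]

/-- The `k`-linear structure on the ind-completion of a `k`-linear category. -/
instance indLinear : Linear k (Ind C) := Linear.ofRingMorphism indCenter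

lemma indYoneda_linear : (Ind.yoneda : C ⥤ Ind C).Linear k where
  map_smul f r := by
    change Ind.yoneda.map (r • f) = indScalar r _ ≫ Ind.yoneda.map f
    rw [indScalar_yoneda, ← Functor.map_comp]
    simp

end IndLinear

section IndCompletion

variable (C : Type u) [Category.{v} C] [EssentiallySmall.{w} C]

/-- The ind-completion of an essentially small category, formed over a small model of it. -/
abbrev IndCompletion : Type (w + 1) := Ind (SmallModel.{w} C)

/-- The canonical embedding of a category in its ind-completion. -/
def toInd : C ⥤ IndCompletion.{w} C :=
  (equivSmallModel.{w} C).functor ⋙ Ind.yoneda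

end IndCompletion

/-! ### Lower finite highest weight categories -/

section LowerFinite

variable (k : Type t) [Field k] (C : Type u) [Category.{v} C] [Abelian C] {Λ : Type x}

/-- A finite length category over `k` (apart from essential smallness): every object has finite
length and all spaces of morphisms are finite dimensional. -/
structure IsFiniteLengthCategory [Linear k C] : Prop where
  finiteLength : ∀ X : C, FiniteLength X
  finite_hom : ∀ X Y : C, Module.Finite k (X ⟶ Y)

variable {C}

/-- The Serre subcategory of `C` attached to `Ω` is a finite abelian category: it has an object `G`
such that all its objects are subquotients of finite direct sums of copies of `G`. -/
def IsFiniteAbelian (L : Λ → C) (Ω : Set Λ) : Prop :=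
  ∃ G : C, FactorsIn L Ω G ∧ ∀ X : C, FactorsIn L Ω X → ∃ n : ℕ,
    IsFactor X (∏ᶜ fun _ : Fin n => G)

/-- A finite filtration `0 = F 0 ⊆ ⋯ ⊆ F n = Y` of a subobject `Y` of `I` whose sections are of the
form `∇ b` with `a ≤ b`. -/
def HasFlag {A : Type u'} [Category.{v'} A] [Abelian A] (P : PartialOrder Λ) (cost : Λ → A)
    (a : Λ) {I : A} (Y : Subobject I) : Prop :=
  ∃ (n : ℕ) (F : ℕ →o Subobject I), F 0 = ⊥ ∧ F n = Y ∧
    ∀ j < n, ∃ b, P.le a b ∧ Nonempty (gr F j ≅ cost b)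

/-- The structure of a lower finite highest weight category on `C` (a finite length category with
simple objects `L a`), for the order `P` on the labels. The injective hulls `hull a` live in the
ind-completion, and `∇ a = Γ_{≤ a} (hull a)` is required to lie in `C`. -/
structure LowerFiniteHighestWeight [EssentiallySmall.{w} C] (L : Λ → C)
    (P : PartialOrder Λ) where
  labels : LabelsSimples L
  lower_finite : ∀ a, {b | P.le b a}.Finite
  finite_abelian : ∀ a, IsFiniteAbelian L {b | P.le b a}
  /-- the injective hulls of the simple objects in the ind-completion -/
  hull : Λ → IndCompletion.{w} C
  /-- the embedding of the simple object in its injective hull -/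
  hullEmb : ∀ a, (toInd.{w} C).obj (L a) ⟶ hull a
  isHull : ∀ a, IsInjectiveHull (hullEmb a)
  /-- the costandard objects -/
  cost : Λ → C
  /-- the embedding of the costandard object in the injective hull -/
  costEmb : ∀ a, (toInd.{w} C).obj (cost a) ⟶ hull a
  costEmb_mono : ∀ a, Mono (costEmb a)
  isGamma : ∀ a, IsGamma (fun b => (toInd.{w} C).obj (L b)) {b | P.le b a}
    (Subobject.mk (costEmb a))
  mult_one : ∀ a, multiplicity (cost a) (L a) = 1
  exists_flags : ∀ a, ∃ 𝒮 : Set (Subobject (hull a)), 𝒮.Nonempty ∧ DirectedOn (· ≤ ·) 𝒮 ∧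
    IsLUB 𝒮 ⊤ ∧ ∀ Y ∈ 𝒮, HasFlag P (fun b => (toInd.{w} C).obj (cost b)) a Y

end LowerFinite

end HW

end

set_option linter.unusedSectionVars false

noncomputable section

/-! Write `A a` and `I a` for `cost a` and `hull a` of the CPS structure, with order ⊏. Costandard
objects have simple socles, so climbing the good filtration shows that a simple subobject `L b` of
`I a / A a` satisfies a ⊏ b and that `A b` is a section of `I a` (`lt_of_mono_cokernel_costHull`).
Controlling Hom(X, `I a / A a`) in this way controls Ext¹(X, `A a`), by injectivity of `I a`.

Claim (1) is then dimension shifting. If `L b` embeds in `A a / L a`, the vanishing of Ext¹(`L a`,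
`A a`) and Ext²(`L a`, `L a`) gives Ext¹(`L a`, `L b`) = 0. By symmetry Ext¹(`L b`, `L a`) = 0, so
`L b` lifts into the socle of `A a`, which is absurd.

Claim (2) and Part II share `mem_of_section`. Suppose `A a` is a section of `I b`. If `L a` in that
section can be lifted to an object `W` with factors in Ω ∪ {a}, then the nonzero image of `W` in `I
b` contains the socle `L b`, so b ∈ Ω ∪ {a}. An obstruction to lifting yields an object with top `L
a` and socle `L c`, where c ∉ Ω ∪ {a} and c ⊏ a; the condition `ExtensionsAbove` forces a ⊏ c
instead. For (2), Ω is empty and the condition follows from the symmetry of Ext¹. For Part II, Ω is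
the set of labels c < a in the lfhw order, and the condition follows by embedding the dual object in
`I a`.

Part II is an induction along the lfhw order (`comparison`). Its other ingredient is
`nonempty_iso_gamma`. Vanishing of Hom into `I a / A a` places Γ = Γ_{≤ a} inside `A a`. If Γ were
smaller, some X in `A a` would have simple top `L m` embedded in `A a` / Γ and radical inside Γ. The
∇-flags allow this `L m` to be extended to an embedding of the dual of X in `A a` / Γ; this makes `L
a` a factor of `A a / L a`, which is impossible. -/

namespace HW

/-! ### Composition factors, simple subobjects and simple tops -/

section Factors

variable {A : Type u} [Category.{v} A] [Abelian A] {Λ : Type x}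

/-- An essential monomorphism, without the condition that it is a monomorphism. -/
def Essential {S X : A} (i : S ⟶ X) : Prop :=
  ∀ ⦃Z : A⦄ (g : X ⟶ Z), Mono (i ≫ g) → Mono g

/-- The notion dual to `Essential`. -/
def Coessential {X S : A} (p : X ⟶ S) : Prop :=
  ∀ ⦃Z : A⦄ (g : Z ⟶ X), Epi (g ≫ p) → Epi g

lemma shortExact_kernel {X Y : A} (p : X ⟶ Y) [Epi p] :
    (ShortComplex.mk (kernel.ι p) p (kernel.condition p)).ShortExact where
  exact := ShortComplex.exact_of_f_is_kernel _ (kernelIsKernel p)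

lemma shortExact_cokernel {X Y : A} (i : X ⟶ Y) [Mono i] :
    (ShortComplex.mk i (cokernel.π i) (cokernel.condition i)).ShortExact where
  exact := ShortComplex.exact_of_g_is_cokernel _ (cokernelIsCokernel i)

lemma IsFactor.refl (X : A) : IsFactor X X :=
  ⟨X, 𝟙 X, 𝟙 X, inferInstance, inferInstance⟩

lemma IsFactor.of_mono {S X Y : A} (f : X ⟶ Y) [Mono f] (h : IsFactor S X) : IsFactor S Y := by
  obtain ⟨Z, i, p, _, _⟩ := h
  exact ⟨Z, i ≫ f, p, inferInstance, inferInstance⟩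

lemma IsFactor.of_epi {S X Y : A} (f : X ⟶ Y) [Epi f] (h : IsFactor S Y) : IsFactor S X := by
  obtain ⟨Z, i, p, _, _⟩ := h
  exact ⟨pullback f i, pullback.fst f i, pullback.snd f i ≫ p, inferInstance, epi_comp _ _⟩

lemma IsFactor.comp_epi {S T X : A} (h : IsFactor S X) (f : S ⟶ T) [Epi f] : IsFactor T X := by
  obtain ⟨Z, i, p, _, _⟩ := h
  exact ⟨Z, i, p ≫ f, inferInstance, epi_comp _ _⟩

lemma isFactor_of_mono {S X : A} (f : S ⟶ X) [Mono f] : IsFactor S X :=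
  (IsFactor.refl S).of_mono f

lemma isFactor_of_epi {S X : A} (f : X ⟶ S) [Epi f] : IsFactor S X :=
  (IsFactor.refl S).of_epi f

/-- Restrict the projection `p` onto `S` to the part lying in `X`. If the restriction is nonzero it
is onto the simple object `S`; if it vanishes, `p` descends to the image in `Z`. -/
lemma IsFactor.of_exact {S X Y Z : A} [Simple S] {f : X ⟶ Y} {g : Y ⟶ Z} {w : f ≫ g = 0}
    [Mono f] (hE : (ShortComplex.mk f g w).Exact) (h : IsFactor S Y) :
    IsFactor S X ∨ IsFactor S Z := by
  obtain ⟨W, i, p, _, _⟩ := h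
  by_cases h0 : kernel.ι (i ≫ g) ≫ p = 0
  · right
    have : Epi (cokernel.desc _ p h0) := by
      have : Epi (cokernel.π (kernel.ι (i ≫ g)) ≫ cokernel.desc _ p h0) := by
        rw [cokernel.π_desc]; infer_instance
      exact epi_of_epi (cokernel.π _) _
    exact ⟨Abelian.coimage (i ≫ g), Abelian.factorThruCoimage (i ≫ g), cokernel.desc _ p h0,
      inferInstance, this⟩
  · left
    have h1 : (kernel.ι (i ≫ g) ≫ i) ≫ g = 0 := by simp
    have : Mono (hE.lift (kernel.ι (i ≫ g) ≫ i) h1) := by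
      have : Mono (hE.lift (kernel.ι (i ≫ g) ≫ i) h1 ≫ f) := by
        have := hE.lift_f (kernel.ι (i ≫ g) ≫ i) h1
        dsimp at this
        rw [this]; infer_instance
      exact mono_of_mono _ f
    exact ⟨_, hE.lift (kernel.ι (i ≫ g) ≫ i) h1, kernel.ι (i ≫ g) ≫ p, this,
      epi_of_nonzero_to_simple h0⟩

lemma not_isFactor_of_isZero {S X : A} [Simple S] (hX : IsZero X) : ¬ IsFactor S X := by
  rintro ⟨Y, i, p, _, _⟩
  have : i = 0 := hX.eq_of_tgt _ _
  have hY : IsZero Y := IsZero.of_mono_eq_zero i this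
  exact Simple.not_isZero S (IsZero.of_epi_eq_zero p (hY.eq_of_src _ _))

lemma iso_of_isFactor_simple {S T : A} [Simple S] [Simple T] (h : IsFactor S T) :
    Nonempty (S ≅ T) := by
  obtain ⟨Y, i, p, _, _⟩ := h
  have hi : i ≠ 0 := fun h => Simple.not_isZero S
    (IsZero.of_epi_eq_zero p ((IsZero.of_mono_eq_zero i h).eq_of_src _ _))
  have := isIso_of_mono_of_nonzero hi
  have : Simple Y := Simple.of_iso (asIso i)
  have hp : p ≠ 0 := fun h => Simple.not_isZero S (IsZero.of_epi_eq_zero p h)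
  have := isIso_of_epi_of_nonzero hp
  exact ⟨(asIso p).symm ≪≫ asIso i⟩

variable {L : Λ → A} {Ω : Set Λ}

lemma FactorsIn.of_mono {X Y : A} (f : X ⟶ Y) [Mono f] (h : FactorsIn L Ω Y) :
    FactorsIn L Ω X := fun a ha => h a (ha.of_mono f)

lemma FactorsIn.of_epi {X Y : A} (f : X ⟶ Y) [Epi f] (h : FactorsIn L Ω X) :
    FactorsIn L Ω Y := fun a ha => h a (ha.of_epi f)

lemma FactorsIn.of_exact (hL : LabelsSimples L) {X Y Z : A} {f : X ⟶ Y} {g : Y ⟶ Z}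
    {w : f ≫ g = 0} [Mono f] (hE : (ShortComplex.mk f g w).Exact) (hX : FactorsIn L Ω X)
    (hZ : FactorsIn L Ω Z) : FactorsIn L Ω Y := fun a ha => by
  have := hL.simple a
  exact (ha.of_exact hE).elim (hX a) (hZ a)

lemma FactorsIn.subset {Ω' : Set Λ} {X : A} (h : FactorsIn L Ω X) (hΩ : Ω ⊆ Ω') :
    FactorsIn L Ω' X := fun a ha => hΩ (h a ha)

lemma factorsIn_simple (hL : LabelsSimples L) {a : Λ} (ha : a ∈ Ω) : FactorsIn L Ω (L a) :=
  fun b hb => by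
    have := hL.simple a
    have := hL.simple b
    rwa [hL.eq_of_iso _ _ (iso_of_isFactor_simple hb)]

lemma LabelsSimples.ne_zero (hL : LabelsSimples L) (a : Λ) {X : A} (f : L a ⟶ X) [Mono f] :
    f ≠ 0 := fun h => by
  have := hL.simple a
  exact Simple.not_isZero (L a) (IsZero.of_mono_eq_zero f h)

lemma LabelsSimples.mono_of_ne_zero (hL : LabelsSimples L) {a : Λ} {X : A} {f : L a ⟶ X}
    (h : f ≠ 0) : Mono f := by
  have := hL.simple a
  exact Preadditive.mono_of_kernel_zero (kernel_zero_of_nonzero_from_simple h)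

lemma LabelsSimples.epi_of_ne_zero (hL : LabelsSimples L) {a : Λ} {X : A} {f : X ⟶ L a}
    (h : f ≠ 0) : Epi f := by
  have := hL.simple a
  exact epi_of_nonzero_to_simple h

lemma LocallyArtinian.exists_simple (hA : LocallyArtinian A) (hL : LabelsSimples L) {X : A}
    (hX : ¬ IsZero X) : ∃ (a : Λ) (s : L a ⟶ X), Mono s := by
  obtain ⟨Y, hY, hY0⟩ : ∃ Y : Subobject X, FiniteLength (Y : A) ∧ ¬ IsZero (Y : A) := by
    by_contra! h
    refine hX ?_
    have h1 : (⊤ : Subobject X) ≤ ⊥ := (hA.union_finiteLength X).2 fun Y hY => by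
      have := h Y hY
      refine Subobject.le_of_comm 0 ?_
      rw [zero_comp]
      exact this.eq_of_src _ _
    have h2 : (⊤ : Subobject X).arrow = 0 := by
      rw [← Subobject.ofLE_arrow h1]; simp
    exact IsZero.of_epi_eq_zero _ h2
  have := hY.1
  obtain ⟨a, ⟨e⟩⟩ := hL.exists_iso _ (inferInstance : Simple (simpleSubobject hY0))
  exact ⟨a, e.inv ≫ simpleSubobjectArrow hY0 ≫ Y.arrow, inferInstance⟩

lemma FiniteLength.of_mono {X Y : A} (f : X ⟶ Y) [Mono f] (h : FiniteLength Y) :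
    FiniteLength X := by
  have := h.1
  have := h.2
  exact ⟨isArtinianObject_of_mono f, isNoetherianObject_of_mono f⟩

/-- Some subobject of finite length is not killed by `p`, since these exhaust `Z`. A minimal
subobject of it with this property has no proper subobject mapping onto `S`. -/
lemma LocallyArtinian.exists_coessential (hA : LocallyArtinian A) {Z S : A} (p : Z ⟶ S)
    [Epi p] [Simple S] : ∃ (X : A) (i : X ⟶ Z), Mono i ∧ FiniteLength X ∧ Epi (i ≫ p) ∧
      Coessential (i ≫ p) := by
  obtain ⟨Y, hY, hY0⟩ : ∃ Y : Subobject Z, FiniteLength (Y : A) ∧ Y.arrow ≫ p ≠ 0 := by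
    by_contra! h
    have h1 : (⊤ : Subobject Z) ≤ kernelSubobject p :=
      (hA.union_finiteLength Z).2 fun Y hY => le_kernelSubobject _ _ (h Y hY)
    have h2 : (⊤ : Subobject Z).arrow ≫ p = 0 := by
      rw [← Subobject.ofLE_arrow h1, Category.assoc, kernelSubobject_arrow_comp, comp_zero]
    have h3 : p = 0 := by rwa [← cancel_epi (⊤ : Subobject Z).arrow, comp_zero]
    exact Simple.not_isZero S (IsZero.of_epi_eq_zero p h3)
  have := hY.1
  obtain ⟨W, hW, hmin⟩ := (wellFounded_lt (α := Subobject (Y : A))).has_min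
    {W | W.arrow ≫ Y.arrow ≫ p ≠ 0} ⟨⊤, fun h => hY0 (by
      rwa [← cancel_epi (⊤ : Subobject (Y : A)).arrow, comp_zero])⟩
  have hp : Epi ((W.arrow ≫ Y.arrow) ≫ p) := by
    rw [Category.assoc]; exact epi_of_nonzero_to_simple hW
  refine ⟨W, W.arrow ≫ Y.arrow, inferInstance, hY.of_mono W.arrow, hp, fun V g hg => ?_⟩
  have hle : Subobject.mk (image.ι g ≫ W.arrow) ≤ W :=
    Subobject.mk_le_of_comm (image.ι g) rfl
  have hne : ¬ Subobject.mk (image.ι g ≫ W.arrow) < W := hmin _ fun h => by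
    rw [← Subobject.underlyingIso_hom_comp_eq_mk, Category.assoc,
      Preadditive.IsIso.comp_left_eq_zero] at h
    have h1 : g ≫ (W.arrow ≫ Y.arrow) ≫ p = 0 := by
      conv_lhs => rw [← image.fac g]
      simp only [Category.assoc] at h ⊢
      rw [h, comp_zero]
    exact Simple.not_isZero S (IsZero.of_epi_eq_zero _ h1)
  have heq := hle.eq_of_not_lt hne
  have hι : Epi (image.ι g) := by
    have h1 := Subobject.ofMkLE_arrow hle
    have h2 : Subobject.ofMkLE _ _ hle = image.ι g := by
      rw [← cancel_mono W.arrow, h1]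
    have h3 : Subobject.ofLE _ _ heq.ge ≫ (Subobject.underlyingIso _).hom ≫ image.ι g = 𝟙 _ := by
      rw [← cancel_mono W.arrow]
      simp
    have : IsSplitEpi (image.ι g) := ⟨⟨⟨Subobject.ofLE _ _ heq.ge ≫ (Subobject.underlyingIso _).hom, by
      rw [Category.assoc, h3]⟩⟩⟩
    infer_instance
  rw [← image.fac g]
  exact epi_comp _ _

end Factors

/-! ### Simple subobjects of the quotient of an injective hull by its costandard object -/

section CPS

variable {A : Type u} [Category.{v} A] [Abelian A] {Λ : Type x} {L : Λ → A}

/-- A nonzero subobject of an essential extension of a simple object contains the latter. -/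
lemma IsInjectiveHull.exists_lift {S I : A} [Simple S] {h : S ⟶ I} (hI : IsInjectiveHull h)
    {X : A} (t : X ⟶ I) [Mono t] (hX : ¬ IsZero X) : ∃ l : S ⟶ X, Mono l ∧ l ≫ t = h := by
  have := hI.mono
  have h0 : h ≫ cokernel.π t = 0 := by
    by_contra h0
    have h1 : Mono (h ≫ cokernel.π t) :=
      Preadditive.mono_of_kernel_zero (kernel_zero_of_nonzero_from_simple h0)
    have h2 := hI.essential _ h1
    have h3 : t = 0 := by rw [← cancel_mono (cokernel.π t)]; simp
    exact hX (IsZero.of_mono_eq_zero t h3)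
  have h4 := Abelian.monoLift_comp t h h0
  have : Mono (Abelian.monoLift t h h0 ≫ t) := by rwa [h4]
  exact ⟨Abelian.monoLift t h h0, mono_of_mono _ t, h4⟩

lemma LabelsSimples.eq_of_mono_hull (hL : LabelsSimples L) {a b : Λ} {I : A} {h : L a ⟶ I}
    (hI : IsInjectiveHull h) (s : L b ⟶ I) [Mono s] : b = a := by
  have := hL.simple a
  have := hL.simple b
  obtain ⟨l, _, -⟩ := hI.exists_lift s (Simple.not_isZero _)
  exact (hL.eq_of_iso _ _ (iso_of_isFactor_simple (isFactor_of_mono l))).symm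

/-- The projection onto a section of a filtration. -/
def grπ {X : A} (F : ℕ →o Subobject X) (n : ℕ) : (F (n + 1) : A) ⟶ gr F n :=
  cokernel.π _

@[simp]
lemma ofLE_comp_grπ {X : A} (F : ℕ →o Subobject X) (n : ℕ) :
    Subobject.ofLE _ _ (F.monotone (Nat.le_succ n)) ≫ grπ F n = 0 :=
  cokernel.condition _

lemma shortExact_gr {X : A} (F : ℕ →o Subobject X) (n : ℕ) :
    (ShortComplex.mk _ _ (ofLE_comp_grπ F n)).ShortExact :=
  shortExact_cokernel _

lemma isZero_of_eq_bot {X : A} {Y : Subobject X} (h : Y = ⊥) : IsZero (Y : A) := by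
  rw [h]; exact IsZero.of_iso (isZero_zero A) Subobject.botCoeIsoZero

lemma isIso_grπ_zero {X : A} {F : ℕ →o Subobject X} (h : F 0 = ⊥) : IsIso (grπ F 0) := by
  have : Epi (grπ F 0) := (shortExact_gr F 0).epi_g
  have : Mono (grπ F 0) := by
    apply Preadditive.mono_of_cancel_zero
    intro Z z hz
    refine ((shortExact_gr F 0).exact.lift_f z hz).symm.trans ?_
    rw [(isZero_of_eq_bot h).eq_of_tgt ((shortExact_gr F 0).exact.lift z hz) 0, zero_comp]
  exact isIso_of_mono_of_epi _

variable {k : Type t} [Field k] [Linear k A] {P : PartialOrder Λ}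
  (H : CPSHighestWeight k L P)

namespace CPSHighestWeight

/-- The embedding of the costandard object in the injective hull given by the first step of the
good filtration. -/
def costHull (a : Λ) : H.cost a ⟶ H.hull a :=
  (H.good a).one.some.inv ≫ (H.filt a 1).arrow

instance mono_costHull (a : Λ) : Mono (H.costHull a) := by
  unfold costHull; infer_instance

lemma mk_costHull (a : Λ) : Subobject.mk (H.costHull a) = H.filt a 1 := by
  exact Subobject.mk_eq_of_comm _ (H.good a).one.some.symm rfl

lemma arrow_comp_π_costHull (a : Λ) : (H.filt a 1).arrow ≫ cokernel.π (H.costHull a) = 0 := by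
  have : (H.filt a 1).arrow = (H.good a).one.some.hom ≫ H.costHull a := by
    simp [costHull]
  rw [this, Category.assoc, cokernel.condition, comp_zero]

lemma eq_of_mono_cost {a b : Λ} (s : L b ⟶ H.cost a) [Mono s] : b = a :=
  H.labels.eq_of_mono_hull (H.isHull a) (s ≫ H.costHull a)

lemma le_of_isFactor_cost {a b : Λ} (h : IsFactor (L b) (H.cost a)) : P.le b a := by
  have := H.labels.simple a
  have := H.labels.simple b
  have := H.emb_mono a
  rcases h.of_exact (shortExact_cokernel (H.emb a)).exact with h | h
  · rw [H.labels.eq_of_iso _ _ (iso_of_isFactor_simple h)]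
  · exact ((P.lt_iff_le_not_ge _ _).1 (H.lt_of_factor a b h)).1

lemma lt_ne {P : PartialOrder Λ} {a b : Λ} (h : P.lt a b) : a ≠ b := fun e => by
  subst e
  exact ((P.lt_iff_le_not_ge _ _).1 h).2 (P.le_refl _)

/-- The labels of the simple subobjects of `hull a / cost a`. -/
lemma lt_of_mono_cokernel_costHull {a b : Λ} (s : L b ⟶ cokernel (H.costHull a)) [Mono s] :
    P.lt a b ∧ ∃ n, Nonempty (gr (H.filt a) n ≅ H.cost b) := by
  have := H.labels.simple b
  set π := cokernel.π (H.costHull a) with hπ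
  -- `T` is the preimage of `L b` in `hull a`. The aim is to find the step of the filtration at
  -- which `T` first leaves `F 1`, which is `cost a`.
  let T : Subobject (H.hull a) := Subobject.mk (pullback.fst π s)
  let F := H.filt a
  have key : ∀ U : Subobject (H.hull a), U ≤ T → ∃ u : (U : A) ⟶ L b, u ≫ s = U.arrow ≫ π := by
    intro U hU
    refine ⟨Subobject.ofLE _ _ hU ≫ (Subobject.underlyingIso _).hom ≫ pullback.snd π s, ?_⟩
    rw [Category.assoc, Category.assoc, ← pullback.condition,
      Subobject.underlyingIso_hom_comp_eq_mk_assoc, Subobject.ofLE_arrow_assoc]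
  -- Otherwise `T = ⋃ (T ⊓ F n)` would lie in `F 1`, and `s` would vanish.
  obtain ⟨N, hN⟩ : ∃ n, ¬ (T ⊓ F n ≤ F 1) := by
    by_contra! h
    have h1 := (H.locallyArtinian.inf_union _ (Set.range F) ⊤ T
      (F.monotone.directed_le.directedOn_range) (H.good a).union).2 (show F 1 ∈ upperBounds _ by
        rintro _ ⟨_, ⟨n, rfl⟩, rfl⟩
        exact h n)
    rw [inf_top_eq] at h1
    have h2 : pullback.fst π s ≫ π = 0 := by
      rw [← Subobject.ofMkLE_arrow h1, Category.assoc, H.arrow_comp_π_costHull, comp_zero]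
    rw [pullback.condition] at h2
    have h3 : pullback.snd π s = 0 := by rwa [← cancel_mono s, zero_comp]
    exact Simple.not_isZero (L b) (IsZero.of_epi_eq_zero _ h3)
  classical
  obtain ⟨m, hm1, hm, hm'⟩ : ∃ m, 1 ≤ m ∧ T ⊓ F m ≤ F 1 ∧ ¬ (T ⊓ F (m + 1) ≤ F 1) := by
    have hs := Nat.find_spec (⟨N, hN⟩ : ∃ n, ¬ (T ⊓ F n ≤ F 1))
    have hmin := fun j => Nat.find_min (⟨N, hN⟩ : ∃ n, ¬ (T ⊓ F n ≤ F 1)) (m := j)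
    set n := Nat.find (⟨N, hN⟩ : ∃ n, ¬ (T ⊓ F n ≤ F 1)) with hn
    have hn1 : 1 < n := by
      by_contra h
      exact hs (inf_le_right.trans (F.monotone (by omega)))
    obtain ⟨m, hm⟩ : ∃ m, n = m + 1 := ⟨n - 1, by omega⟩
    refine ⟨m, by omega, ?_, hm ▸ hs⟩
    exact not_not.1 (hmin m (by omega))
  let U := T ⊓ F (m + 1)
  obtain ⟨u, hu⟩ := key U inf_le_left
  have hu0 : u ≠ 0 := by
    intro h
    rw [h, zero_comp] at hu
    apply hm'
    have h1 := Abelian.monoLift_comp (H.costHull a) U.arrow hu.symm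
    have h2 : U ≤ Subobject.mk (H.costHull a) := Subobject.le_mk_of_comm _ h1
    rwa [mk_costHull] at h2
  have := epi_of_nonzero_to_simple hu0
  let v : (U : A) ⟶ gr F m := Subobject.ofLE U (F (m + 1)) inf_le_right ≫ grπ F m
  have hv0 : v ≠ 0 := by
    intro h
    apply hm'
    have h1 := (shortExact_gr F m).exact.lift_f _ h
    have h2 : U ≤ F m := Subobject.le_of_comm ((shortExact_gr F m).exact.lift _ h) (by
      have := congr_arg (· ≫ (F (m + 1)).arrow) h1
      simpa using this)
    exact (le_inf inf_le_left h2).trans hm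
  -- The kernel of `u` lies in `cost a`, that is in `F 1 ≤ F m` because `1 ≤ m`. Hence `v` descends
  -- along `u` to an embedding of `L b` in the section `gr F m`, whose socle then determines its
  -- label.
  have hker : kernel.ι u ≫ v = 0 := by
    have h1 : (kernel.ι u ≫ U.arrow) ≫ π = 0 := by
      rw [Category.assoc, ← hu, kernel.condition_assoc, zero_comp]
    have h2 := Abelian.monoLift_comp (H.costHull a) _ h1
    have h3 : (F m).Factors (kernel.ι u ≫ U.arrow) := by
      refine Subobject.factors_of_le _ (F.monotone hm1) ?_
      rw [← H.mk_costHull a, Subobject.mk_factors_iff]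
      exact ⟨_, h2⟩
    have h4 : kernel.ι u ≫ Subobject.ofLE U (F (m + 1)) inf_le_right =
        (F m).factorThru _ h3 ≫ Subobject.ofLE _ _ (F.monotone (Nat.le_succ m)) := by
      rw [← cancel_mono (F (m + 1)).arrow]
      simp
    dsimp only [v]
    rw [← Category.assoc, h4, Category.assoc, ofLE_comp_grπ, comp_zero]
  have hw := Abelian.comp_epiDesc u v hker
  have hw0 : Abelian.epiDesc u v hker ≠ 0 := fun h => hv0 (by rw [← hw, h, comp_zero])
  have := H.labels.mono_of_ne_zero hw0
  rcases (H.good a).step m hm1 with h | ⟨c, hc, ⟨e⟩⟩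
  · exfalso
    apply hm'
    dsimp only [F]
    rwa [h]
  · obtain rfl := H.eq_of_mono_cost (Abelian.epiDesc u v hker ≫ e.hom)
    exact ⟨hc, m, ⟨e⟩⟩

/-- A morphism to `hull a / cost a` vanishes as soon as no composition factor of its source is the
label of a simple subobject of the target. -/
lemma eq_zero_of_forall {a : Λ} {Ω : Set Λ} {X : A} (hX : FactorsIn L Ω X)
    (h : ∀ b ∈ Ω, ∀ s : L b ⟶ cokernel (H.costHull a), ¬ Mono s)
    (f : X ⟶ cokernel (H.costHull a)) : f = 0 := by
  by_contra h0
  have hI : ¬ IsZero (Abelian.image f) := fun hz => h0 (by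
    rw [← Abelian.image.fac f, hz.eq_of_tgt (Abelian.factorThruImage f) 0, zero_comp])
  obtain ⟨b, s, _⟩ := H.locallyArtinian.exists_simple H.labels hI
  refine h b ?_ (s ≫ Abelian.image.ι f) inferInstance
  exact hX.of_epi (Abelian.factorThruImage f) b (isFactor_of_mono s)

end CPSHighestWeight

end CPS

/-! ### Lifting objects with prescribed factors through extensions -/

section Lifting

variable {A : Type u} [Category.{v} A] [Abelian A] {Λ : Type x} {L : Λ → A} {Ω : Set Λ}

/-- The third isomorphism theorem: the quotient of `E / N'` by `N / N'` is `E / N`. -/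
lemma shortExact_cokernel_comp {N' N N'' E Q : A} {f : N' ⟶ N} {g : N ⟶ N''} {i : N ⟶ E}
    {q : E ⟶ Q} {w : f ≫ g = 0} {w' : i ≫ q = 0} [Epi g] (hfg : (ShortComplex.mk f g w).Exact)
    (hiq : (ShortComplex.mk i q w').ShortExact) :
    ∃ (a : N'' ⟶ cokernel (f ≫ i)) (b : cokernel (f ≫ i) ⟶ Q) (w'' : a ≫ b = 0),
      (ShortComplex.mk a b w'').ShortExact ∧ g ≫ a = i ≫ cokernel.π (f ≫ i) ∧
        cokernel.π (f ≫ i) ≫ b = q := by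
  have : Mono i := hiq.mono_f
  have : Epi q := hiq.epi_g
  have hf : f ≫ i ≫ cokernel.π (f ≫ i) = 0 := by
    rw [← Category.assoc, cokernel.condition]
  have ha : g ≫ hfg.desc _ hf = i ≫ cokernel.π (f ≫ i) := hfg.g_desc _ hf
  have hb : (f ≫ i) ≫ q = 0 := by rw [Category.assoc, w', comp_zero]
  have hab : hfg.desc _ hf ≫ cokernel.desc _ q hb = 0 := by
    rw [← cancel_epi g, ← Category.assoc, ha]
    simp [w']
  have h0 : (ShortComplex.mk (f ≫ i) (cokernel.π (f ≫ i)) (cokernel.condition _)).Exact :=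
    ShortComplex.exact_of_g_is_cokernel _ (cokernelIsCokernel _)
  refine ⟨hfg.desc _ hf, cokernel.desc _ q hb, hab, .mk' ?_ ?_ ?_, ha, cokernel.π_desc _ _ _⟩
  · rw [ShortComplex.exact_iff_exact_up_to_refinements]
    intro Z z hz
    dsimp at z hz ⊢
    obtain ⟨Z', ρ, _, e, he⟩ := surjective_up_to_refinements_of_epi (cokernel.π (f ≫ i)) z
    have h1 : e ≫ q = 0 := by
      rw [← cokernel.π_desc (f ≫ i) q hb, ← Category.assoc, ← he, Category.assoc, hz, comp_zero]
    refine ⟨Z', ρ, inferInstance, hiq.exact.lift e h1 ≫ g, ?_⟩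
    have h2 : hiq.exact.lift e h1 ≫ i = e := hiq.exact.lift_f e h1
    rw [Category.assoc, ha, ← Category.assoc, h2, he]
  · apply Preadditive.mono_of_cancel_zero
    intro Z z hz
    dsimp at z hz
    obtain ⟨Z', ρ, _, n, hn⟩ := surjective_up_to_refinements_of_epi g z
    have h1 : (n ≫ i) ≫ cokernel.π (f ≫ i) = 0 := by
      rw [Category.assoc, ← ha, ← Category.assoc, ← hn, Category.assoc, hz, comp_zero]
    obtain ⟨Z'', ρ', _, n', hn'⟩ := h0.exact_up_to_refinements _ h1
    dsimp at hn' n'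
    have h2 : ρ' ≫ n = n' ≫ f := by
      rw [← cancel_mono i]; simpa using hn'
    rw [← cancel_epi ρ, ← cancel_epi ρ', hn, ← Category.assoc, h2, Category.assoc, w]
    simp
  · have : Epi (cokernel.π (f ≫ i) ≫ cokernel.desc _ q hb) := by
      rw [cokernel.π_desc]; infer_instance
    exact epi_of_epi (cokernel.π (f ≫ i)) _

/-- Base change of a short exact sequence. -/
lemma shortExact_pullback {X Y Z W : A} {f : X ⟶ Y} {g : Y ⟶ Z} {w : f ≫ g = 0}
    (hfg : (ShortComplex.mk f g w).ShortExact) (h : W ⟶ Z) :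
    (ShortComplex.mk (pullback.lift f 0 (by simp [w]) : X ⟶ pullback g h) (pullback.snd g h)
      (pullback.lift_snd _ _ _)).ShortExact := by
  have : Mono f := hfg.mono_f
  have : Epi g := hfg.epi_g
  refine .mk' ?_ ?_ ?_
  · rw [ShortComplex.exact_iff_exact_up_to_refinements]
    intro T z hz
    dsimp at z hz ⊢
    have h1 : (z ≫ pullback.fst g h) ≫ g = 0 := by
      rw [Category.assoc, pullback.condition, ← Category.assoc, hz, zero_comp]
    refine ⟨T, 𝟙 T, inferInstance, hfg.exact.lift _ h1, ?_⟩
    have h2 : hfg.exact.lift _ h1 ≫ f = z ≫ pullback.fst g h := hfg.exact.lift_f _ h1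
    apply pullback.hom_ext
    · rw [Category.assoc, Category.assoc, pullback.lift_fst, Category.id_comp]
      exact h2.symm
    · rw [Category.assoc, Category.assoc, pullback.lift_snd, Category.id_comp, hz, comp_zero]
  · have : Mono ((pullback.lift f 0 (by simp [w]) : X ⟶ pullback g h) ≫ pullback.fst g h) := by
      rw [pullback.lift_fst]; infer_instance
    exact mono_of_mono _ (pullback.fst g h)
  · dsimp; infer_instance

/-- A simple subobject of a quotient `Y / N` is covered by a subobject `X` of `Y` of finite length
with simple top. -/
lemma LocallyArtinian.exists_coessential_cokernel (hA : LocallyArtinian A) {N Y S : A} [Simple S]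
    (d : N ⟶ Y) [Mono d] (s : S ⟶ cokernel d) [Mono s] :
    ∃ (X : A) (x : X ⟶ Y) (p : X ⟶ S) (r : kernel p ⟶ N), Mono x ∧ FiniteLength X ∧ Epi p ∧
      Coessential p ∧ Mono r ∧ x ≫ cokernel.π d = p ≫ s ∧ r ≫ d = kernel.ι p ≫ x := by
  obtain ⟨X, i, _, hX, hepi, hco⟩ := hA.exists_coessential (pullback.snd (cokernel.π d) s)
  set p := i ≫ pullback.snd (cokernel.π d) s with hp
  have h1 : (i ≫ pullback.fst (cokernel.π d) s) ≫ cokernel.π d = p ≫ s := by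
    rw [hp, Category.assoc, pullback.condition, Category.assoc]
  have h2 : (kernel.ι p ≫ i ≫ pullback.fst (cokernel.π d) s) ≫ cokernel.π d = 0 := by
    rw [Category.assoc, h1, kernel.condition_assoc, zero_comp]
  have h3 := Abelian.monoLift_comp d _ h2
  exact ⟨X, i ≫ pullback.fst _ _, p, Abelian.monoLift d _ h2, inferInstance, hX, hepi, hco,
    mono_of_mono_fac h3, h1, h3⟩

variable (L Ω) in
/-- Every extension of an object `Q` with composition factors in `Ω` by `N` contains an object with
composition factors in `Ω` that covers `Q`. -/
def LiftsFactorsIn (N : A) : Prop :=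
  ∀ ⦃E Q : A⦄ (i : N ⟶ E) (q : E ⟶ Q) (w : i ≫ q = 0), (ShortComplex.mk i q w).ShortExact →
    FactorsIn L Ω Q → ∃ (W : A) (f : W ⟶ E), FactorsIn L Ω W ∧ Epi (f ≫ q)

lemma LiftsFactorsIn.of_factorsIn (hL : LabelsSimples L) {N : A} (hN : FactorsIn L Ω N) :
    LiftsFactorsIn L Ω N := fun E Q i q w h hQ => by
  have : Mono i := h.mono_f
  have : Epi q := h.epi_g
  exact ⟨E, 𝟙 E, hN.of_exact hL h.exact hQ, by rwa [Category.id_comp]⟩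

lemma LiftsFactorsIn.of_iso {N N' : A} (hN : LiftsFactorsIn L Ω N) (e : N ≅ N') :
    LiftsFactorsIn L Ω N' := fun E Q i q w h hQ => by
  have h1 : (ShortComplex.mk (e.hom ≫ i) q (by rw [Category.assoc, w, comp_zero])).ShortExact :=
    ShortComplex.shortExact_of_iso (S₁ := .mk i q w) (ShortComplex.isoMk e.symm (Iso.refl _)
      (Iso.refl _) (by simp) (by simp)) h
  exact hN _ _ _ h1 hQ

/-- Lift first to `E / N'`, an extension of `Q` by `N''`, then lift the resulting cover through
`N'`. This stability makes the notion pass to filtrations whose sections are of two kinds: those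
with factors in `Ω`, and those with no nonsplit extension by objects with factors in `Ω`. -/
lemma LiftsFactorsIn.of_shortExact {N' N N'' : A} {f : N' ⟶ N} {g : N ⟶ N''} {w : f ≫ g = 0}
    (h : (ShortComplex.mk f g w).ShortExact) (h' : LiftsFactorsIn L Ω N')
    (h'' : LiftsFactorsIn L Ω N'') : LiftsFactorsIn L Ω N := fun E Q i q w' hiq hQ => by
  have : Mono f := h.mono_f
  have : Epi g := h.epi_g
  have : Mono i := hiq.mono_f
  obtain ⟨a, b, w'', hab, -, hb⟩ := shortExact_cokernel_comp h.exact hiq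
  obtain ⟨W'', f'', hW'', hepi⟩ := h'' a b w'' hab hQ
  obtain ⟨W, f₁, hW, hepi'⟩ := h' _ _ _
    (shortExact_pullback (shortExact_cokernel (f ≫ i)) f'') hW''
  refine ⟨W, f₁ ≫ pullback.fst _ _, hW, ?_⟩
  have : (f₁ ≫ pullback.fst _ _) ≫ q = (f₁ ≫ pullback.snd _ _) ≫ f'' ≫ b := by
    rw [← hb, Category.assoc, Category.assoc, ← pullback.condition_assoc]
  rw [this]
  exact epi_comp _ _

end Lifting

/-! ### Which good filtrations contain a given costandard object -/

namespace CPSHighestWeight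

variable {A : Type u} [Category.{v} A] [Abelian A] {Λ : Type x} {L : Λ → A} {Ω : Set Λ}
variable {k : Type t} [Field k] [Linear k A] {P : PartialOrder Λ}
  (H : CPSHighestWeight k L P)

/-- The hypothesis makes the extension split: the map `E ⟶ hull a` extending `costHull a` lands in
`cost a`, giving a retraction of `i`. Its kernel is the required cover of `Q`. -/
lemma liftsFactorsIn_cost {a : Λ}
    (h : ∀ Q, FactorsIn L Ω Q → ∀ f : Q ⟶ cokernel (H.costHull a), f = 0) :
    LiftsFactorsIn L Ω (H.cost a) := fun E Q i q w hiq hQ => by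
  have : Mono i := hiq.mono_f
  have : Epi q := hiq.epi_g
  have := (H.isHull a).injective
  let g : E ⟶ H.hull a := Injective.factorThru (H.costHull a) i
  have hg : i ≫ g = H.costHull a := Injective.comp_factorThru _ _
  have h1 : i ≫ g ≫ cokernel.π (H.costHull a) = 0 := by
    rw [← Category.assoc, hg, cokernel.condition]
  have h2 : q ≫ hiq.exact.desc _ h1 = g ≫ cokernel.π (H.costHull a) := hiq.exact.g_desc _ h1
  rw [h Q hQ (hiq.exact.desc _ h1), comp_zero] at h2
  let r := Abelian.monoLift (H.costHull a) g h2.symm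
  have hr : r ≫ H.costHull a = g := Abelian.monoLift_comp _ _ _
  have hir : i ≫ r = 𝟙 _ := by
    rw [← cancel_mono (H.costHull a), Category.assoc, hr, hg, Category.id_comp]
  have hm : Mono (kernel.ι r ≫ q) := by
    apply Preadditive.mono_of_cancel_zero
    intro Z z hz
    have h3 : (z ≫ kernel.ι r) ≫ q = 0 := by rwa [Category.assoc]
    have h4 : hiq.exact.lift _ h3 ≫ i = z ≫ kernel.ι r := hiq.exact.lift_f _ h3
    have h5 : hiq.exact.lift _ h3 = 0 := by
      rw [← Category.comp_id (hiq.exact.lift _ h3)]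
      change _ ≫ 𝟙 (H.cost a) = 0
      rw [← hir, ← Category.assoc, h4]
      simp
    rw [← cancel_mono (kernel.ι r), ← h4, h5, zero_comp, zero_comp]
  refine ⟨kernel r, kernel.ι r, hQ.of_mono (kernel.ι r ≫ q), ?_⟩
  let s : E ⟶ kernel r := kernel.lift r (𝟙 E - r ≫ i) (by
    rw [Preadditive.sub_comp, Category.assoc, hir]; simp)
  have hs : s ≫ kernel.ι r ≫ q = q := by
    rw [← Category.assoc, kernel.lift_ι, Preadditive.sub_comp, Category.assoc, w]; simp
  have : Epi (s ≫ kernel.ι r ≫ q) := by rw [hs]; infer_instance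
  exact epi_of_epi s _

lemma liftsFactorsIn_filtration (h : ∀ c, LiftsFactorsIn L Ω (H.cost c)) {b : Λ}
    {F : ℕ →o Subobject (H.hull b)} (hF : IsGoodFiltration P H.cost b F) (n : ℕ) :
    LiftsFactorsIn L Ω (F n : A) := by
  rcases Nat.eq_zero_or_pos n with rfl | hn
  · rw [hF.zero]
    refine LiftsFactorsIn.of_factorsIn H.labels fun a ha => ?_
    have := H.labels.simple a
    exact (not_isFactor_of_isZero (isZero_of_eq_bot rfl) ha).elim
  · induction n, hn using Nat.le_induction with
    | base => exact (h b).of_iso hF.one.some.symm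
    | succ n hn ih =>
      rcases hF.step n hn with h1 | ⟨c, -, ⟨e⟩⟩
      · rwa [h1]
      · exact LiftsFactorsIn.of_shortExact (shortExact_gr F n) ih ((h c).of_iso e.symm)

/-- Take `V` maximal among the subobjects whose quotient has a factor outside `Ω`. In `R / V` every
nonzero subobject must then absorb all the factors outside `Ω`, which is what produces a simple
socle below. -/
lemma exists_maximal_quotient {R : A} [IsNoetherianObject R] (hR : ¬ FactorsIn L Ω R) :
    ∃ V : Subobject R, ¬ FactorsIn L Ω (cokernel V.arrow) ∧
      ∀ (B : A) (b : B ⟶ cokernel V.arrow), Mono b → ¬ IsZero B →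
        FactorsIn L Ω (cokernel b) := by
  obtain ⟨V, hV, hmax⟩ := (wellFounded_gt (α := Subobject R)).has_min
    {V | ¬ FactorsIn L Ω (cokernel V.arrow)} ⟨⊥, fun h => hR (by
      have : Mono (cokernel.π (⊥ : Subobject R).arrow) := by
        apply Preadditive.mono_of_cancel_zero
        intro Z z hz
        refine (Abelian.monoLift_comp _ _ hz).symm.trans ?_
        exact (congr_arg (_ ≫ ·) Subobject.bot_arrow).trans comp_zero
      exact h.of_mono (cokernel.π (⊥ : Subobject R).arrow))⟩
  refine ⟨V, hV, fun B b _ hB => ?_⟩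
  by_contra hb
  let q := cokernel.π V.arrow ≫ cokernel.π b
  have hle : V ≤ kernelSubobject q := le_kernelSubobject _ _ (by simp [q])
  have hV' : kernelSubobject q ∈ {V | ¬ FactorsIn L Ω (cokernel V.arrow)} := fun h => hb (by
    have : Epi (cokernel.desc (kernelSubobject q).arrow q (kernelSubobject_arrow_comp q)) := by
      have : Epi (cokernel.π (kernelSubobject q).arrow ≫
          cokernel.desc (kernelSubobject q).arrow q (kernelSubobject_arrow_comp q)) := by
        rw [cokernel.π_desc]; exact epi_comp _ _
      exact epi_of_epi (cokernel.π _) _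
    exact h.of_epi (cokernel.desc (kernelSubobject q).arrow q (kernelSubobject_arrow_comp q)))
  have hge : kernelSubobject q ≤ V := (hle.eq_of_not_lt (hmax _ hV')).ge
  have h1 : (kernelSubobject q).Factors (pullback.fst (cokernel.π V.arrow) b) := by
    rw [kernelSubobject_factors_iff]
    simp only [q]
    rw [← Category.assoc, pullback.condition, Category.assoc, cokernel.condition, comp_zero]
  have h2 : pullback.snd (cokernel.π V.arrow) b ≫ b = 0 := by
    rw [← pullback.condition, ← Subobject.factorThru_arrow _ _ (Subobject.factors_of_le _ hge h1),
      Category.assoc, cokernel.condition, comp_zero]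
  have h3 : b = 0 := by rwa [← cancel_epi (pullback.snd (cokernel.π V.arrow) b), comp_zero]
  exact hB (IsZero.of_mono_eq_zero b h3)

/-- The condition on extensions of `L a` used in the analysis of good filtrations: if `X` has
simple top `L a` and simple socle `L c` with `c ∉ Ω ∪ {a}`, and all the other composition factors
of `X` have labels in `Ω`, then `a < c`. -/
def ExtensionsAbove (L : Λ → A) (P : PartialOrder Λ) (Ω : Set Λ) (a : Λ) : Prop :=
  ∀ ⦃c : Λ⦄ ⦃X₀ X R : A⦄ (e : X₀ ⟶ X) (r : R ⟶ X) (p : X ⟶ L a) (w : r ≫ p = 0) (s : L c ⟶ R),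
    FiniteLength X₀ → Epi e → (ShortComplex.mk r p w).ShortExact → Coessential p → Mono s →
    Essential (s ≫ r) → FactorsIn L Ω (cokernel s) → c ∉ insert a Ω → P.lt a c

/-- Cover `L a` by a subobject `X` of `hull b` with simple top and radical inside `cost b`. A
suitable quotient of `X` has top `L a` and socle `L c` with c ∉ Ω. As `L c` is a factor of `cost b`,
one gets c ≤ b < a, against the conclusion a < c of `ExtensionsAbove`. -/
lemma not_mono_of_extensionsAbove {a : Λ} (h : ExtensionsAbove L P Ω a) {b : Λ}
    (hb : b ∉ insert a Ω) (s : L a ⟶ cokernel (H.costHull b)) : ¬ Mono s := fun _ => by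
  have := H.labels.simple a
  have := H.labels.simple b
  have hlt := (H.lt_of_mono_cokernel_costHull s).1
  obtain ⟨X, x, p, r₀, _, hX, _, hco, _, -, -⟩ :=
    H.locallyArtinian.exists_coessential_cokernel (H.costHull b) s
  -- The radical is nonzero, since otherwise `L a` would embed in `hull b` although b < a. Hence it
  -- contains the socle `L b`, and b ∉ Ω.
  have hR : ¬ FactorsIn L Ω (kernel p) := by
    intro hΩ
    have hnz : ¬ IsZero (kernel p) := by
      intro hz
      have : Mono p := Preadditive.mono_of_isZero_kernel _ hz
      have : IsIso p := isIso_of_mono_of_epi p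
      exact lt_ne hlt (H.labels.eq_of_mono_hull (H.isHull b) (inv p ≫ x)).symm
    obtain ⟨l, _, -⟩ := (H.isHull b).exists_lift (r₀ ≫ H.costHull b) hnz
    exact hb (Or.inr (hΩ b (isFactor_of_mono l)))
  have : IsNoetherianObject (kernel p) := (hX.of_mono (kernel.ι p)).2
  obtain ⟨V, hV, hmax⟩ := exists_maximal_quotient hR
  obtain ⟨f, v, w, hfv, -, hv⟩ := shortExact_cokernel_comp (shortExact_cokernel V.arrow).exact
    (shortExact_kernel p)
  have := hfv.mono_f
  dsimp at this
  have hco' : Coessential v := by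
    intro Y g hg
    have h1 : pullback.fst (cokernel.π (V.arrow ≫ kernel.ι p)) g ≫ p =
        pullback.snd (cokernel.π (V.arrow ≫ kernel.ι p)) g ≫ g ≫ v := by
      rw [← pullback.condition_assoc, hv]
    have h2 : Epi (pullback.fst (cokernel.π (V.arrow ≫ kernel.ι p)) g) := hco _ (by
      rw [h1]; exact epi_comp _ _)
    have h3 : Epi (pullback.snd (cokernel.π (V.arrow ≫ kernel.ι p)) g ≫ g) := by
      rw [← pullback.condition]; exact epi_comp _ _
    exact epi_of_epi (pullback.snd (cokernel.π (V.arrow ≫ kernel.ι p)) g) g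
  have hR0 : ¬ IsZero (cokernel V.arrow) := fun hz => hV fun c hc => by
    have := H.labels.simple c
    exact (not_isFactor_of_isZero hz hc).elim
  obtain ⟨c, j, _⟩ := H.locallyArtinian.exists_simple H.labels hR0
  have := H.labels.simple c
  have hj := hmax _ j inferInstance (Simple.not_isZero _)
  have hcΩ : c ∉ Ω := fun hc =>
    hV ((factorsIn_simple H.labels hc).of_exact H.labels (shortExact_cokernel j).exact hj)
  have hca : P.lt c a := by
    have h1 : IsFactor (L c) (H.cost b) :=
      ((isFactor_of_mono j).of_epi (cokernel.π V.arrow)).of_mono r₀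
    have h2 := H.le_of_isFactor_cost h1
    let := P
    exact lt_of_le_of_lt h2 hlt
  -- A nonzero kernel of `g` either lies in `R / V`, where by maximality it contains `L c`, or maps
  -- onto the top `L a` and is then everything. In both cases `g` kills `L c`.
  have hess : Essential (j ≫ f) := by
    intro G g hg
    by_contra hgm
    have hB : ¬ IsZero (kernel g) := fun hz => hgm (Preadditive.mono_of_isZero_kernel _ hz)
    by_cases h0 : kernel.ι g ≫ v = 0
    · have h1 : hfv.exact.lift _ h0 ≫ f = kernel.ι g := hfv.exact.lift_f _ h0
      set β : kernel g ⟶ cokernel V.arrow := hfv.exact.lift _ h0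
      have : Mono β := by
        have : Mono (β ≫ f) := by rw [h1]; infer_instance
        exact mono_of_mono β f
      have h2 := hmax _ β inferInstance hB
      have h3 : j ≫ cokernel.π β ≠ 0 := fun h3 => by
        have h4 := Abelian.monoLift_comp _ _ h3
        refine H.labels.ne_zero c ((j ≫ f) ≫ g) ?_
        rw [← h4, Category.assoc _ β f, h1, Category.assoc, kernel.condition, comp_zero]
      have := H.labels.mono_of_ne_zero h3
      exact hcΩ (h2 c (isFactor_of_mono (j ≫ cokernel.π β)))
    · have := H.labels.epi_of_ne_zero h0
      have := hco' _ this
      have h1 : g = 0 := by rw [← cancel_epi (kernel.ι g)]; simp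
      exact H.labels.ne_zero c ((j ≫ f) ≫ g) (by rw [h1, comp_zero])
  have hac := h _ f v w j hX (inferInstance : Epi (cokernel.π (V.arrow ≫ kernel.ι p))) hfv hco'
    inferInstance hess hj (fun hc => hc.elim (lt_ne hca) hcΩ)
  let := P
  exact lt_asymm hca hac

/-- Control on the good filtrations in which `cost a` appears. -/
theorem mem_of_section {a : Λ} (h₁ : ∀ c ∈ insert a Ω, FactorsIn L (insert a Ω) (H.cost c))
    (h₂ : ∀ c ∈ Ω, ∀ b n, Nonempty (gr (H.filt b) n ≅ H.cost c) → b ∈ insert a Ω)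
    (h₃ : ExtensionsAbove L P Ω a) {b : Λ} {F : ℕ →o Subobject (H.hull b)}
    (hF : IsGoodFiltration P H.cost b F) {n : ℕ} (e : gr F n ≅ H.cost a) :
    b ∈ insert a Ω := by
  have := H.labels.simple a
  have := H.labels.simple b
  have := H.emb_mono a
  have hcost : ∀ c, LiftsFactorsIn L (insert a Ω) (H.cost c) := by
    intro c
    by_cases hc : c ∈ insert a Ω
    · exact LiftsFactorsIn.of_factorsIn H.labels (h₁ c hc)
    · refine H.liftsFactorsIn_cost fun Q hQ f => H.eq_zero_of_forall hQ (fun d hd s hs => ?_) f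
      -- For `d = a` the previous lemma applies. For `d ∈ Ω`, an embedding of `L d` makes `cost d` a
      -- section of `hull c`, so `h₂` puts `c` in `insert a Ω`.
      rcases hd with rfl | hd
      · exact H.not_mono_of_extensionsAbove h₃ hc s hs
      · obtain ⟨-, m, hm⟩ := H.lt_of_mono_cokernel_costHull s
        exact hc (h₂ d hd c m hm)
  -- The preimage of `L a ⊆ cost a ≅ gr F n` in `F (n + 1)` is an extension of `L a` by `F n`.
  obtain ⟨W, f, hW, hf⟩ := H.liftsFactorsIn_filtration hcost hF n _ _ _
    (shortExact_pullback (shortExact_gr F n) (H.emb a ≫ e.inv))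
    (factorsIn_simple H.labels (Set.mem_insert a Ω))
  let g : W ⟶ H.hull b := f ≫ pullback.fst (grπ F n) (H.emb a ≫ e.inv) ≫ (F (n + 1)).arrow
  have hg : ¬ IsZero (Abelian.image g) := by
    intro hz
    have h1 : g = 0 := by
      rw [← Abelian.image.fac g, hz.eq_of_tgt (Abelian.factorThruImage g) 0, zero_comp]
    have h2 : f = 0 := by
      rw [← cancel_mono (pullback.fst (grπ F n) (H.emb a ≫ e.inv) ≫ (F (n + 1)).arrow), zero_comp]
      exact h1
    rw [h2, zero_comp] at hf
    exact Simple.not_isZero (L a) (IsZero.of_epi_eq_zero (0 : W ⟶ L a) rfl)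
  obtain ⟨l, _, -⟩ := (H.isHull b).exists_lift (Abelian.image.ι g) hg
  exact hW.of_epi (Abelian.factorThruImage g) b (isFactor_of_mono l)

end CPSHighestWeight

/-! ### Consequences of the long exact sequences of Ext -/

section Ext

open Abelian

variable {A : Type u} [Category.{v} A] [Abelian A] [HasExt.{w'} A]
  {X Y Z : A} {f : X ⟶ Y} {g : Y ⟶ Z} {w : f ≫ g = 0}
  (h : (ShortComplex.mk f g w).ShortExact) (T : A)

include h

lemma subsingleton_ext_one_left (hT : ∀ t : T ⟶ Z, t = 0) [Subsingleton (Ext T Y 1)] :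
    Subsingleton (Ext T X 1) := by
  refine subsingleton_of_forall_eq 0 fun e => ?_
  obtain ⟨e', rfl⟩ := Ext.covariant_sequence_exact₁ T h e (Subsingleton.elim _ _) (zero_add 1)
  obtain ⟨t, rfl⟩ := Ext.addEquiv₀.symm.surjective e'
  rw [hT t]
  simp

lemma subsingleton_ext_one_middle [Subsingleton (Ext T X 1)] [Subsingleton (Ext T Z 1)] :
    Subsingleton (Ext T Y 1) := by
  refine subsingleton_of_forall_eq 0 fun e => ?_
  obtain ⟨e', rfl⟩ := Ext.covariant_sequence_exact₂ T h e (Subsingleton.elim _ _)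
  rw [Subsingleton.elim e' 0, Ext.zero_comp]

lemma subsingleton_ext_one_right [Subsingleton (Ext T Y 1)] [Subsingleton (Ext T X 2)] :
    Subsingleton (Ext T Z 1) := by
  refine subsingleton_of_forall_eq 0 fun e => ?_
  obtain ⟨e', rfl⟩ := Ext.covariant_sequence_exact₃ T h e (n₁ := 2) rfl (Subsingleton.elim _ _)
  rw [Subsingleton.elim e' 0, Ext.zero_comp]

lemma exists_lift_of_subsingleton_ext {T : A} [Subsingleton (Ext T X 1)] (t : T ⟶ Z) :
    ∃ t' : T ⟶ Y, t' ≫ g = t := by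
  obtain ⟨e, he⟩ := Ext.covariant_sequence_exact₃ T h (Ext.mk₀ t) (n₁ := 1) (zero_add 1)
    (Subsingleton.elim _ _)
  obtain ⟨t', rfl⟩ := Ext.addEquiv₀.symm.surjective e
  refine ⟨t', Ext.addEquiv₀.symm.injective ?_⟩
  simpa using he

lemma exists_extension_of_subsingleton_ext {T : A} [Subsingleton (Ext Z T 1)] (t : X ⟶ T) :
    ∃ t' : Y ⟶ T, f ≫ t' = t := by
  obtain ⟨e, he⟩ := Ext.contravariant_sequence_exact₁ h T (Ext.mk₀ t) (n₁ := 1) (add_zero 1)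
    (Subsingleton.elim _ _)
  obtain ⟨t', rfl⟩ := Ext.addEquiv₀.symm.surjective e
  refine ⟨t', Ext.addEquiv₀.symm.injective ?_⟩
  simpa using he

end Ext

lemma isIso_of_isZero_cokernel {A : Type u} [Category.{v} A] [Abelian A] {X Y : A} (f : X ⟶ Y)
    [Mono f] (h : IsZero (cokernel f)) : IsIso f := by
  have : Epi f := Preadditive.epi_of_isZero_cokernel _ h
  exact isIso_of_mono_of_epi f

/-! ### Part I -/

namespace CPSHighestWeight

open Abelian

variable {A : Type u} [Category.{v} A] [Abelian A] [HasExt.{w'} A] {Λ : Type x} {L : Λ → A}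
  {k : Type t} [Field k] [Linear k A] {P : PartialOrder Λ} (H : CPSHighestWeight k L P)

lemma subsingleton_ext_cost {a : Λ} {X : A} (h : ∀ f : X ⟶ cokernel (H.costHull a), f = 0) :
    Subsingleton (Ext X (H.cost a) 1) := by
  have := (H.isHull a).injective
  have : Subsingleton (Ext X (H.hull a) 1) := Ext.subsingleton_of_injective _ _ 0
  exact subsingleton_ext_one_left (shortExact_cokernel (H.costHull a)) X h

lemma eq_zero_of_not_lt {a b : Λ} (h : ¬ P.lt a b) (f : L b ⟶ cokernel (H.costHull a)) :
    f = 0 := by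
  by_contra h0
  have := H.labels.mono_of_ne_zero h0
  exact h (H.lt_of_mono_cokernel_costHull f).1

lemma lt_irrefl (a : Λ) : ¬ P.lt a a := fun h => lt_ne h rfl

theorem isIso_emb_of_subsingleton_ext {a : Λ}
    (h : ∀ b, Subsingleton (Ext (L a) (L b) 1) → Subsingleton (Ext (L b) (L a) 1))
    (h2 : Subsingleton (Ext (L a) (L a) 2)) : IsIso (H.emb a) := by
  have := H.emb_mono a
  by_contra hiso
  have hQ : ¬ IsZero (cokernel (H.emb a)) := fun hz => hiso (isIso_of_isZero_cokernel _ hz)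
  obtain ⟨b, s, _⟩ := H.locallyArtinian.exists_simple H.labels hQ
  have hba := H.lt_of_factor a b (isFactor_of_mono s)
  have : Subsingleton (Ext (L a) (H.cost a) 1) :=
    H.subsingleton_ext_cost (H.eq_zero_of_not_lt (lt_irrefl a))
  have : Subsingleton (Ext (L a) (cokernel (H.emb a)) 1) :=
    subsingleton_ext_one_right (shortExact_cokernel (H.emb a)) (L a)
  -- `L a` is not a factor of `cost a / L a`, so Ext¹(`L a`, `L b`) injects into Ext¹(`L a`, `cost a
  -- / L a`) = 0.
  have : Subsingleton (Ext (L a) (L b) 1) := by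
    refine subsingleton_ext_one_left (shortExact_cokernel s) (L a) fun f => ?_
    by_contra h0
    have := H.labels.mono_of_ne_zero h0
    exact lt_irrefl a (H.lt_of_factor a a ((isFactor_of_mono f).of_epi (cokernel.π s)))
  have := h b this
  obtain ⟨f, hf⟩ := exists_lift_of_subsingleton_ext (shortExact_cokernel (H.emb a)) s
  have : Mono f := mono_of_mono_fac hf
  exact lt_ne hba (H.eq_of_mono_cost f)

/-- With `Ω` empty, the object in question is an extension of `L a` by `L c`. Unless a < c, Ext¹(`L
c`, `L a`) vanishes because `L a` is costandard. By symmetry the extension splits, contradicting the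
simple top. -/
lemma extensionsAbove_empty {a : Λ} (ha : IsIso (H.emb a))
    (h : ∀ b, Subsingleton (Ext (L b) (L a) 1) → Subsingleton (Ext (L a) (L b) 1)) :
    ExtensionsAbove L P ∅ a := by
  intro c X₀ X R e r p w s _ _ hrp hp _ _ hs hc
  by_contra hlt
  have hz : IsZero (cokernel s) := by
    by_contra hz
    obtain ⟨d, j, _⟩ := H.locallyArtinian.exists_simple H.labels hz
    exact hs d (isFactor_of_mono j)
  have hz' : IsZero (cokernel (H.emb a)) := isZero_cokernel_of_epi _
  have := H.emb_mono a
  have : Subsingleton (Ext (L c) (H.cost a) 1) :=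
    H.subsingleton_ext_cost (H.eq_zero_of_not_lt hlt)
  have : Subsingleton (Ext (L c) (L a) 1) :=
    subsingleton_ext_one_left (shortExact_cokernel (H.emb a)) _ fun f => hz'.eq_of_tgt _ _
  have := h c this
  have := hz.injective
  have : Subsingleton (Ext (L a) (cokernel s) 1) := Ext.subsingleton_of_injective _ _ 0
  have : Subsingleton (Ext (L a) R 1) := subsingleton_ext_one_middle (shortExact_cokernel s) _
  obtain ⟨σ, hσ⟩ := exists_lift_of_subsingleton_ext hrp (𝟙 (L a))
  have : Epi σ := hp σ (by rw [hσ]; infer_instance)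
  have : Mono σ := mono_of_mono_fac hσ
  have : IsIso σ := isIso_of_mono_of_epi σ
  have : Mono r := hrp.mono_f
  have := H.labels.simple a
  have := H.labels.simple c
  exact hc (Or.inl (H.labels.eq_of_iso _ _
    (iso_of_isFactor_simple (isFactor_of_mono (s ≫ r ≫ inv σ)))))

theorem section_iff_of_isIso_emb {a : Λ} (ha : IsIso (H.emb a))
    (h : ∀ b, Subsingleton (Ext (L b) (L a) 1) → Subsingleton (Ext (L a) (L b) 1))
    {b : Λ} {F : ℕ →o Subobject (H.hull b)} (hF : IsGoodFiltration P H.cost b F) :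
    (∃ n, Nonempty (gr F n ≅ H.cost a)) ↔ b = a := by
  constructor
  · rintro ⟨n, ⟨e⟩⟩
    have := H.mem_of_section (Ω := ∅) (a := a) (fun c hc => ?_) (by simp)
      (H.extensionsAbove_empty ha h) hF e
    · simpa using this
    · obtain rfl : c = a := by simpa using hc
      exact (factorsIn_simple H.labels (Set.mem_insert _ _)).of_epi (H.emb c)
  · rintro rfl
    have := isIso_grπ_zero hF.zero
    exact ⟨0, ⟨(asIso (grπ F 0)).symm ≪≫ hF.one.some⟩⟩

end CPSHighestWeight

/-! ### Duality on finite length objects -/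

section Duals

variable {A : Type u} [Category.{v} A] [Abelian A] {Λ : Type x}

/-- The objects which are quotients of objects of finite length have duals, with respect to an
exact duality which preserves the simple objects `L a`. -/
def HasDuals (L : Λ → A) : Prop :=
  ∀ ⦃X₀ X : A⦄ (e : X₀ ⟶ X), FiniteLength X₀ → Epi e → ∃ U : A,
    (∀ ⦃a : Λ⦄ ⦃R : A⦄ (r : R ⟶ X) (p : X ⟶ L a) (w : r ≫ p = 0),
      (ShortComplex.mk r p w).ShortExact → Coessential p →
      ∃ (V : A) (i : L a ⟶ U) (q : U ⟶ V) (w' : i ≫ q = 0),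
        (ShortComplex.mk i q w').ShortExact ∧ Essential i ∧
        ∀ c, IsFactor (L c) V ↔ IsFactor (L c) R) ∧
    (∀ ⦃a : Λ⦄ ⦃Q : A⦄ (s : L a ⟶ X) (q : X ⟶ Q) (w : s ≫ q = 0),
      (ShortComplex.mk s q w).ShortExact →
      ∃ (V : A) (i : V ⟶ U) (p : U ⟶ L a) (w' : i ≫ p = 0),
        (ShortComplex.mk i p w').ShortExact ∧ ∀ c, IsFactor (L c) V ↔ IsFactor (L c) Q)

lemma isFactor_iff_of_iso {S S' X X' : A} (e : S ≅ S') (f : X ≅ X') :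
    IsFactor S X ↔ IsFactor S' X' :=
  ⟨fun h => (h.comp_epi e.hom).of_mono f.hom, fun h => (h.comp_epi e.inv).of_mono f.inv⟩

end Duals

/-! ### Exact full embeddings with separating image, and transport of the duality -/

section Embedding

open scoped ZeroObject

variable {C : Type u} [Category.{v} C] [Abelian C] {B : Type u'} [Category.{v'} B] [Abelian B]
  {F : C ⥤ B} [F.Full] [F.Faithful] [PreservesFiniteLimits F] [PreservesFiniteColimits F]

variable (F) in
/-- The objects in the image of `F` form a separating family. -/
def Separating : Prop :=
  ∀ ⦃X Y : B⦄ (g : X ⟶ Y), (∀ (T : C) (f : F.obj T ⟶ X), f ≫ g = 0) → g = 0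

variable (hF : Separating F)

include hF

/-- Choose a map from the image of `F` with maximal image in `X`. Adding any other such map via a
biproduct cannot enlarge it, so its cokernel vanishes by separation. -/
lemma exists_epi_of_isNoetherianObject (X : B) [IsNoetherianObject X] :
    ∃ (T : C) (f : F.obj T ⟶ X), Epi f := by
  have : F.Additive := Functor.additive_of_preserves_binary_products F
  obtain ⟨_, ⟨⟨T, f⟩, rfl⟩, hmax⟩ := (wellFounded_gt (α := Subobject X)).has_min
    (Set.range fun p : Σ T : C, F.obj T ⟶ X => imageSubobject p.2) ⟨_, ⟨⟨0, 0⟩, rfl⟩⟩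
  refine ⟨T, f, Preadditive.epi_of_cokernel_zero (hF _ fun T' g => ?_)⟩
  let h : F.obj (T ⊞ T') ⟶ X := F.map biprod.fst ≫ f + F.map biprod.snd ≫ g
  have hf : F.map biprod.inl ≫ h = f := by
    simp [h, ← Functor.map_comp_assoc]
  have hg : F.map biprod.inr ≫ h = g := by
    simp [h, ← Functor.map_comp_assoc]
  have h1 : imageSubobject f ≤ imageSubobject h := by
    conv_lhs => rw [← hf]
    exact imageSubobject_comp_le _ _
  have h2 : imageSubobject h ≤ imageSubobject f := (h1.eq_of_not_lt (hmax _ ⟨⟨_, h⟩, rfl⟩)).ge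
  have h3 : imageSubobject g ≤ imageSubobject f := by
    refine le_trans ?_ h2
    conv_lhs => rw [← hg]
    exact imageSubobject_comp_le _ _
  have h4 : (imageSubobject f).arrow ≫ cokernel.π f = 0 := by
    rw [← cancel_epi (factorThruImageSubobject f)]
    simp
  rw [← imageSubobject_arrow_comp g, ← Subobject.ofLE_arrow h3, Category.assoc, Category.assoc,
    h4, comp_zero, comp_zero]

/-- The same maximality argument, run inside the noetherian object `T` of `C`: each map `F.obj S ⟶
K` gives a subobject of `T`, and `F` of a maximal one is `K`. -/
lemma exists_iso_of_mono {T : C} [IsNoetherianObject T] {K : B} (i : K ⟶ F.obj T) [Mono i] :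
    ∃ (T₀ : C) (j : T₀ ⟶ T) (e : F.obj T₀ ≅ K), Mono j ∧ e.hom ≫ i = F.map j := by
  have : F.Additive := Functor.additive_of_preserves_binary_products F
  obtain ⟨_, ⟨⟨S, f⟩, rfl⟩, hmax⟩ := (wellFounded_gt (α := Subobject T)).has_min
    (Set.range fun p : Σ S : C, F.obj S ⟶ K => imageSubobject (F.preimage (p.2 ≫ i)))
    ⟨_, ⟨⟨0, 0⟩, rfl⟩⟩
  dsimp only at hmax
  set f₀ := F.preimage (f ≫ i) with hf₀
  let m := image.ι f₀
  let q := factorThruImage f₀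
  have hqm : F.map q ≫ F.map m = f ≫ i := by
    rw [← F.map_comp, image.fac, hf₀, F.map_preimage]
  have hker : kernel.ι (F.map q) ≫ f = 0 := by
    rw [← cancel_mono i, Category.assoc, ← hqm, kernel.condition_assoc]; simp
  let φ := Abelian.epiDesc (F.map q) f hker
  have hφ : F.map q ≫ φ = f := Abelian.comp_epiDesc _ _ _
  have hφi : φ ≫ i = F.map m := by
    rw [← cancel_epi (F.map q), ← Category.assoc, hφ, hqm]
  have hepi : Epi f := by
    refine Preadditive.epi_of_cokernel_zero (hF _ fun T' g => ?_)
    let h : F.obj (S ⊞ T') ⟶ K := F.map biprod.fst ≫ f + F.map biprod.snd ≫ g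
    have h1 : biprod.inl ≫ F.preimage (h ≫ i) = f₀ := by
      apply F.map_injective
      simp [h, hf₀, ← Functor.map_comp_assoc]
    have h2 : biprod.inr ≫ F.preimage (h ≫ i) = F.preimage (g ≫ i) := by
      apply F.map_injective
      simp [h, ← Functor.map_comp_assoc]
    have h3 : imageSubobject f₀ ≤ imageSubobject (F.preimage (h ≫ i)) := by
      conv_lhs => rw [← h1]
      exact imageSubobject_comp_le _ _
    have h4 := (h3.eq_of_not_lt (hmax _ ⟨⟨_, h⟩, rfl⟩)).ge
    have h5 : imageSubobject (F.preimage (g ≫ i)) ≤ imageSubobject f₀ := by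
      refine le_trans ?_ h4
      conv_lhs => rw [← h2]
      exact imageSubobject_comp_le _ _
    obtain ⟨l, hl⟩ : ∃ l : T' ⟶ image f₀, l ≫ m = F.preimage (g ≫ i) := by
      refine ⟨factorThruImageSubobject _ ≫ Subobject.ofLE _ _ h5 ≫
        (imageSubobjectIso f₀).hom, ?_⟩
      simp [m]
    have h6 : g = F.map l ≫ φ := by
      rw [← cancel_mono i, Category.assoc, hφi, ← F.map_comp, hl, F.map_preimage]
    have h7 : φ ≫ cokernel.π f = 0 := by
      rw [← cancel_epi (F.map q), ← Category.assoc, hφ, cokernel.condition, comp_zero]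
    rw [h6, Category.assoc, h7, comp_zero]
  have : Epi φ := epi_of_epi_fac hφ
  have : Mono φ := mono_of_mono_fac hφi
  have : IsIso φ := isIso_of_mono_of_epi φ
  exact ⟨image f₀, m, asIso φ, inferInstance, hφi⟩

variable (hC : ∀ X : C, IsNoetherianObject X)

include hC

lemma exists_shortExact_of_shortExact {T : C} {R X Q : B} (φ : F.obj T ≅ X) {r : R ⟶ X}
    {p : X ⟶ Q} {w : r ≫ p = 0} (h : (ShortComplex.mk r p w).ShortExact) :
    ∃ (R₀ Q₀ : C) (r₀ : R₀ ⟶ T) (p₀ : T ⟶ Q₀) (w₀ : r₀ ≫ p₀ = 0) (α : F.obj R₀ ≅ R)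
      (β : F.obj Q₀ ≅ Q), (ShortComplex.mk r₀ p₀ w₀).ShortExact ∧
        F.map r₀ ≫ φ.hom = α.hom ≫ r ∧ F.map p₀ ≫ β.hom = φ.hom ≫ p := by
  have : Mono r := h.mono_f
  have : Epi p := h.epi_g
  have := hC T
  obtain ⟨R₀, r₀, α, _, hα⟩ := exists_iso_of_mono hF (r ≫ φ.inv)
  have hα' : F.map r₀ ≫ φ.hom = α.hom ≫ r := by
    rw [← hα]; simp
  have h0 := (shortExact_cokernel r₀).map_of_exact F
  have hp : F.map r₀ ≫ φ.hom ≫ p = 0 := by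
    rw [← Category.assoc, hα', Category.assoc, w, comp_zero]
  have hπ : r ≫ φ.inv ≫ F.map (cokernel.π r₀) = 0 := by
    rw [← cancel_epi α.hom, ← Category.assoc r, ← Category.assoc, hα, ← F.map_comp,
      cokernel.condition, F.map_zero, comp_zero]
  have : Epi (F.map (cokernel.π r₀)) := inferInstance
  have := h0.epi_g
  obtain ⟨β, e1⟩ : ∃ β : F.obj (cokernel r₀) ⟶ Q, F.map (cokernel.π r₀) ≫ β = φ.hom ≫ p :=
    ⟨h0.exact.desc _ hp, h0.exact.g_desc _ hp⟩
  obtain ⟨γ, e2⟩ : ∃ γ : Q ⟶ F.obj (cokernel r₀), p ≫ γ = φ.inv ≫ F.map (cokernel.π r₀) :=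
    ⟨h.exact.desc _ hπ, h.exact.g_desc _ hπ⟩
  have hβγ : β ≫ γ = 𝟙 _ := by
    rw [← cancel_epi (F.map (cokernel.π r₀)), ← Category.assoc, e1, Category.assoc, e2]
    simp
  have hγβ : γ ≫ β = 𝟙 _ := by
    rw [← cancel_epi p, ← Category.assoc, e2, Category.assoc, e1]
    simp
  exact ⟨R₀, cokernel r₀, r₀, cokernel.π r₀, cokernel.condition _, α, ⟨β, γ, hβγ, hγβ⟩,
    shortExact_cokernel r₀, hα', e1⟩

lemma exists_iso_of_epi {X₀ X : B} [IsNoetherianObject X₀] (e : X₀ ⟶ X) [Epi e] :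
    ∃ T : C, Nonempty (F.obj T ≅ X) := by
  obtain ⟨T, f, _⟩ := exists_epi_of_isNoetherianObject hF X₀
  have : Epi (f ≫ e) := epi_comp _ _
  obtain ⟨_, Q₀, -, -, -, -, β, -⟩ :=
    exists_shortExact_of_shortExact hF hC (Iso.refl _) (shortExact_kernel (f ≫ e))
  exact ⟨Q₀, ⟨β⟩⟩

lemma isFactor_map_iff {S X : C} : IsFactor (F.obj S) (F.obj X) ↔ IsFactor S X := by
  constructor
  · rintro ⟨Y, i, p, _, _⟩
    have := hC X
    obtain ⟨T, j, e, hj, -⟩ := exists_iso_of_mono hF i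
    refine ⟨T, j, F.preimage (e.hom ≫ p), hj, ?_⟩
    apply F.epi_of_epi_map
    rw [F.map_preimage]
    exact epi_comp _ _
  · rintro ⟨Y, i, p, _, _⟩
    exact ⟨F.obj Y, F.map i, F.map p, inferInstance, inferInstance⟩

/-- The kernel of a map out of `F.obj X` comes from a subobject of `X` in `C`, so essentiality can
be tested there. -/
lemma Essential.map {S X : C} {i : S ⟶ X} (h : Essential i) : Essential (F.map i) := by
  intro Z g hg
  have := hC X
  obtain ⟨T, j, e, _, hj⟩ := exists_iso_of_mono hF (kernel.ι g)
  have h1 : Mono (i ≫ cokernel.π j) := by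
    apply Preadditive.mono_of_cancel_zero
    intro Y z hz
    rw [← Category.assoc] at hz
    have h2 := Abelian.monoLift_comp j _ hz
    apply F.map_injective
    rw [← cancel_mono (F.map i ≫ g), ← Category.assoc, ← F.map_comp, ← h2, F.map_comp, ← hj]
    simp
  have h3 := h _ h1
  have h4 : j = 0 := by rw [← cancel_mono (cokernel.π j)]; simp
  apply Preadditive.mono_of_kernel_zero
  rw [← cancel_epi e.hom, hj, h4]
  simp

omit hF hC in
lemma Coessential.of_map {S X : C} {p : X ⟶ S} (h : Coessential (F.map p)) : Coessential p := by
  intro Z g hg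
  apply F.epi_of_epi_map
  apply h
  rw [← F.map_comp]
  infer_instance

omit hF hC in
lemma Essential.iso_comp {S S' X : C} {i : S ⟶ X} (h : Essential i) (e : S' ≅ S) :
    Essential (e.hom ≫ i) := by
  intro Z g hg
  apply h
  have : i ≫ g = e.inv ≫ (e.hom ≫ i) ≫ g := by simp
  rw [this]
  exact mono_comp _ _

omit hF hC in
lemma Coessential.comp_iso {S S' X X' : C} {p : X ⟶ S} (h : Coessential p) {p' : X' ⟶ S'}
    (e : X' ≅ X) (f : S' ≅ S) (hp : p' ≫ f.hom = e.hom ≫ p) : Coessential p' := by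
  intro Z g hg
  have h1 : (g ≫ e.hom) ≫ p = (g ≫ p') ≫ f.hom := by simp [hp]
  have h2 : Epi (g ≫ e.hom) := h _ (by rw [h1]; exact epi_comp _ _)
  have h3 : g = (g ≫ e.hom) ≫ e.inv := by simp
  rw [h3]
  exact epi_comp _ _

omit hF hC in
lemma isFactor_dual (G : Cᵒᵖ ⥤ C) [G.IsEquivalence] {S X : C} (h : IsFactor S X) :
    IsFactor (G.obj (.op S)) (G.obj (.op X)) := by
  obtain ⟨Y, i, p, _, _⟩ := h
  exact (isFactor_of_mono (G.map p.op)).of_epi (G.map i.op)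

omit hF hC in
lemma isFactor_of_dual (G : Cᵒᵖ ⥤ C) [G.IsEquivalence] {S X : C}
    (h : IsFactor (G.obj (.op S)) (G.obj (.op X))) : IsFactor S X := by
  obtain ⟨Y, i, p, _, _⟩ := h
  let e := G.objObjPreimageIso Y
  let i' := G.preimage (e.hom ≫ i)
  let p' := G.preimage (e.hom ≫ p)
  have : Mono i' := G.mono_of_mono_map (by rw [G.map_preimage]; infer_instance)
  have : Epi p' := G.epi_of_epi_map (by rw [G.map_preimage]; exact epi_comp _ _)
  exact (isFactor_of_mono p'.unop).of_epi i'.unop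

omit hF hC in
lemma Coessential.dual (G : Cᵒᵖ ⥤ C) [G.IsEquivalence] {S X : C} {p : X ⟶ S}
    (h : Coessential p) : Essential (G.map p.op) := by
  intro Z g hg
  let e := G.objObjPreimageIso Z
  let q := G.preimage (g ≫ e.inv)
  have hq : G.map q = g ≫ e.inv := G.map_preimage _
  have h1 : Mono (p.op ≫ q) := G.mono_of_mono_map (by
    rw [G.map_comp, hq, ← Category.assoc]
    exact mono_comp _ _)
  have h2 : Epi (q.unop ≫ p) := by
    have : q.unop ≫ p = (p.op ≫ q).unop := rfl
    rw [this]; infer_instance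
  have h3 : Epi q.unop := h _ h2
  have h4 : Mono q := by
    have : q = q.unop.op := rfl
    rw [this]; infer_instance
  have h5 : g = G.map q ≫ e.hom := by simp [hq]
  rw [h5]
  infer_instance

/-- A quotient of a noetherian object of `B` is isomorphic to some `F.obj T`, and its short exact
sequences come from `C`. The dual is `F` applied to the dual of `T`. -/
theorem hasDuals {Λ : Type x} {L : Λ → C} (Ψ : Cᵒᵖ ≌ C)
    (hΨ : ∀ a, Nonempty (Ψ.functor.obj (.op (L a)) ≅ L a)) : HasDuals fun a => F.obj (L a) := by
  intro X₀ X e hX₀ _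
  have := hX₀.2
  obtain ⟨T, ⟨φ⟩⟩ := exists_iso_of_epi hF hC e
  let G := Ψ.functor
  have hfac : ∀ (R : C) (c : Λ),
      IsFactor (F.obj (L c)) (F.obj (G.obj (.op R))) ↔ IsFactor (F.obj (L c)) (F.obj R) := by
    intro R c
    obtain ⟨i⟩ := hΨ c
    rw [isFactor_map_iff hF hC, isFactor_map_iff hF hC,
      ← isFactor_iff_of_iso i (Iso.refl (G.obj (.op R)))]
    exact ⟨isFactor_of_dual G, isFactor_dual G⟩
  refine ⟨F.obj (G.obj (.op T)), ?_, ?_⟩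
  · intro a R r p w h hp
    obtain ⟨R₀, Q₀, r₀, p₀, w₀, α, β, h₀, hα, hβ⟩ :=
      exists_shortExact_of_shortExact hF hC φ h
    have hp₀ : Coessential p₀ := Coessential.of_map (hp.comp_iso (C := B) φ β hβ)
    obtain ⟨i⟩ := hΨ a
    let j : L a ≅ G.obj (.op Q₀) := i.symm ≪≫ G.mapIso (F.preimageIso β).op
    have h2 : F.map (G.map p₀.op) ≫ F.map (G.map r₀.op) = 0 := by
      rw [← F.map_comp, ← G.map_comp, ← op_comp, w₀]; simp
    have h1 : (ShortComplex.mk _ _ h2).ShortExact :=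
      ((h₀.op.map_of_exact G).map_of_exact F)
    refine ⟨F.obj (G.obj (.op R₀)), F.map (j.hom ≫ G.map p₀.op), F.map (G.map r₀.op), ?_, ?_, ?_,
      ?_⟩
    · rw [← F.map_comp, Category.assoc, ← G.map_comp, ← op_comp, w₀]; simp
    · exact ShortComplex.shortExact_of_iso (S₁ := .mk _ _ h2) (ShortComplex.isoMk (F.mapIso j.symm) (Iso.refl _)
        (Iso.refl _) (by simp) (by simp)) h1
    · exact Essential.map hF hC ((hp₀.dual G).iso_comp j)
    · intro c
      rw [hfac]
      exact isFactor_iff_of_iso (Iso.refl _) α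
  · intro a Q s q w h
    obtain ⟨R₀, Q₀, r₀, p₀, w₀, α, β, h₀, hα, hβ⟩ :=
      exists_shortExact_of_shortExact hF hC φ h
    obtain ⟨i⟩ := hΨ a
    let j : G.obj (.op R₀) ≅ L a := G.mapIso (F.preimageIso α).symm.op ≪≫ i
    have h2 : F.map (G.map p₀.op) ≫ F.map (G.map r₀.op) = 0 := by
      rw [← F.map_comp, ← G.map_comp, ← op_comp, w₀]; simp
    have h1 : (ShortComplex.mk _ _ h2).ShortExact :=
      ((h₀.op.map_of_exact G).map_of_exact F)
    refine ⟨F.obj (G.obj (.op Q₀)), F.map (G.map p₀.op), F.map (G.map r₀.op ≫ j.hom), ?_, ?_, ?_⟩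
    · rw [← F.map_comp, ← Category.assoc, ← G.map_comp, ← op_comp, w₀]; simp
    · exact ShortComplex.shortExact_of_iso (S₁ := .mk _ _ h2) (ShortComplex.isoMk (Iso.refl _) (Iso.refl _)
        (F.mapIso j) (by simp) (by simp)) h1
    · intro c
      rw [hfac]
      exact isFactor_iff_of_iso (Iso.refl _) β

end Embedding

/-! ### The embedding in the ind-completion -/

section Ind

variable (C : Type u) [Category.{v} C] [EssentiallySmall.{w} C] [Abelian C]

instance : (toInd.{w} C).Full := by unfold toInd; infer_instance
instance : (toInd.{w} C).Faithful := by unfold toInd; infer_instance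
instance : PreservesFiniteLimits (toInd.{w} C) := by unfold toInd; infer_instance
instance : PreservesFiniteColimits (toInd.{w} C) := by unfold toInd; infer_instance

lemma separating_toInd : Separating (toInd.{w} C) := by
  intro X Y g h
  refine ind_hom_ext _ _ fun T f => ?_
  have h1 := h ((equivSmallModel C).inverse.obj T)
    (Ind.yoneda.map ((equivSmallModel C).counit.app T) ≫ f)
  rw [comp_zero, ← cancel_epi (Ind.yoneda.map ((equivSmallModel C).counit.app T)), comp_zero,
    ← Category.assoc]
  exact h1

end Ind

/-! ### Injective hulls exhausted by ∇-flags -/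

section Flags

open Abelian

variable {A : Type u} [Category.{v} A] [Abelian A] {Λ : Type x} {L : Λ → A} {P : PartialOrder Λ}

lemma IsInjectiveHull.exists_lift_of_mono {S I : A} [Simple S] {h : S ⟶ I}
    (hI : IsInjectiveHull h) (s : S ⟶ I) [Mono s] {X : A} (t : X ⟶ I) [Mono t]
    (hX : ¬ IsZero X) : ∃ l : S ⟶ X, Mono l ∧ l ≫ t = s := by
  obtain ⟨l, _, hl⟩ := hI.exists_lift s (Simple.not_isZero S)
  have : IsIso l := isIso_of_mono_of_nonzero fun h0 =>
    Simple.not_isZero S (IsZero.of_mono_eq_zero l h0)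
  obtain ⟨l', _, hl'⟩ := hI.exists_lift t hX
  exact ⟨inv l ≫ l', inferInstance, by rw [Category.assoc, hl', ← hl, IsIso.inv_hom_id_assoc]⟩

lemma IsInjectiveHull.nonempty_iso {S I I' : A} {h : S ⟶ I} {h' : S ⟶ I'}
    (hI : IsInjectiveHull h) (hI' : IsInjectiveHull h') : Nonempty (I ≅ I') := by
  have := hI.injective
  have := hI'.injective
  have := hI.mono
  have := hI'.mono
  have h1 : h ≫ Injective.factorThru h' h = h' := Injective.comp_factorThru _ _
  have : Mono (Injective.factorThru h' h) := hI.essential _ (by rw [h1]; infer_instance)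
  let g : I' ⟶ I := Injective.factorThru (𝟙 I) (Injective.factorThru h' h)
  have h2 : Injective.factorThru h' h ≫ g = 𝟙 I := Injective.comp_factorThru _ _
  have h3 : h' ≫ g = h := by
    conv_lhs => rw [← h1, Category.assoc, h2, Category.comp_id]
  have : Mono g := hI'.essential _ (by rw [h3]; infer_instance)
  have : Epi g := epi_of_epi_fac h2
  have : IsIso g := isIso_of_mono_of_epi g
  exact ⟨(asIso g).symm⟩

/-- A noetherian subobject of a directed union is contained in one of the terms. -/
lemma LocallyArtinian.exists_le (hA : LocallyArtinian A) {X : A} {𝒮 : Set (Subobject X)}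
    (hne : 𝒮.Nonempty) (hdir : DirectedOn (· ≤ ·) 𝒮) (hlub : IsLUB 𝒮 ⊤) (M : Subobject X)
    [IsNoetherianObject (M : A)] : ∃ Y ∈ 𝒮, M ≤ Y := by
  obtain ⟨_, ⟨Y, hY, rfl⟩, hmax⟩ := (wellFounded_gt (α := Subobject (M : A))).has_min
    ((fun Y => (Subobject.pullback M.arrow).obj Y) '' 𝒮) (hne.image _)
  refine ⟨Y, hY, ?_⟩
  have h1 := (hA.inf_union X 𝒮 ⊤ M hdir hlub).2 (show Y ∈ upperBounds _ by
    rintro _ ⟨Z, hZ, rfl⟩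
    obtain ⟨W, hW, hYW, hZW⟩ := hdir Y hY Z hZ
    have h2 : (Subobject.pullback M.arrow).obj Y ≤ (Subobject.pullback M.arrow).obj W :=
      (Subobject.pullback M.arrow).monotone hYW
    have h3 := h2.eq_of_not_lt (hmax _ ⟨W, hW, rfl⟩)
    have h4 : M ⊓ Y = M ⊓ W := by
      rw [Subobject.inf_eq_map_pullback, Subobject.inf_eq_map_pullback, h3]
    exact ((inf_le_inf_left M hZW).trans h4.ge).trans inf_le_right)
  rwa [inf_top_eq] at h1

lemma subsingleton_ext_of_iso [HasExt.{w'} A] {T X Y : A} (e : X ≅ Y) [Subsingleton (Ext T X 1)] :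
    Subsingleton (Ext T Y 1) := by
  refine subsingleton_of_forall_eq 0 fun z => ?_
  have h : (z.comp (Ext.mk₀ e.inv) (add_zero 1)).comp (Ext.mk₀ e.hom) (add_zero 1) = z := by
    simp
  rw [← h, Subsingleton.elim (z.comp (Ext.mk₀ e.inv) (add_zero 1)) 0, Ext.zero_comp]

lemma IsGamma.exists_lift {Ω : Set Λ} {X : A} {N : Subobject X} (hN : IsGamma L Ω N) {T : A}
    (hT : FactorsIn L Ω T) (t : T ⟶ X) : ∃ t' : T ⟶ N, t' ≫ N.arrow = t := by
  have h1 : Subobject.mk (Abelian.image.ι t) ≤ N := hN.2 (by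
    have := hT.of_epi (Abelian.factorThruImage t)
    exact this.of_mono (Subobject.underlyingIso _).hom)
  refine ⟨Abelian.factorThruImage t ≫ Subobject.ofMkLE _ _ h1, ?_⟩
  rw [Category.assoc, Subobject.ofMkLE_arrow, Abelian.image.fac]

variable (L P) in
/-- Injective hulls of the simple objects whose subobjects `Γ_{≤ a}` give rise to flags. -/
structure FlaggedHulls where
  labels : LabelsSimples L
  locallyArtinian : LocallyArtinian A
  hull : Λ → A
  hullEmb : ∀ a, L a ⟶ hull a
  isHull : ∀ a, IsInjectiveHull (hullEmb a)
  gamma : ∀ a, Subobject (hull a)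
  isGamma : ∀ a, IsGamma L {b | P.le b a} (gamma a)
  exists_flags : ∀ a, ∃ 𝒮 : Set (Subobject (hull a)), 𝒮.Nonempty ∧ DirectedOn (· ≤ ·) 𝒮 ∧
    IsLUB 𝒮 ⊤ ∧ ∀ Y ∈ 𝒮, HasFlag P (fun b => (gamma b : A)) a Y

namespace FlaggedHulls

variable (D : FlaggedHulls L P)

/-- The pullback of `Q` to `hull a` is an extension of `Q` by `gamma a`, so its factors are all ≤ a.
By maximality it maps into `gamma a`. -/
lemma hom_cokernel_eq_zero {a : Λ} {Q : A} (hQ : FactorsIn L {b | P.le b a} Q)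
    (f : Q ⟶ cokernel (D.gamma a).arrow) : f = 0 := by
  have h := shortExact_pullback (shortExact_cokernel (D.gamma a).arrow) f
  have := h.mono_f
  have hT := FactorsIn.of_exact D.labels h.exact (D.isGamma a).1 hQ
  obtain ⟨t', ht'⟩ := (D.isGamma a).exists_lift hT (pullback.fst _ _)
  have h1 : pullback.snd (cokernel.π (D.gamma a).arrow) f ≫ f = 0 := by
    rw [← pullback.condition, ← ht', Category.assoc, cokernel.condition, comp_zero]
  rwa [← cancel_epi (pullback.snd (cokernel.π (D.gamma a).arrow) f), comp_zero]

lemma exists_mono_gamma (a : Λ) : ∃ l : L a ⟶ (D.gamma a : A), Mono l ∧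
    l ≫ (D.gamma a).arrow = D.hullEmb a := by
  have := (D.isHull a).mono
  obtain ⟨l, hl⟩ := (D.isGamma a).exists_lift
    (factorsIn_simple D.labels (Ω := {b | P.le b a}) (P.le_refl a)) (D.hullEmb a)
  exact ⟨l, mono_of_mono_fac hl, hl⟩

lemma not_isZero_gamma (a : Λ) : ¬ IsZero (D.gamma a : A) := fun hz => by
  obtain ⟨l, _, -⟩ := D.exists_mono_gamma a
  exact D.labels.ne_zero a l (hz.eq_of_tgt _ _)

variable [HasExt.{w'} A]

lemma subsingleton_ext_gamma {a : Λ} {Q : A} (hQ : FactorsIn L {b | P.le b a} Q) :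
    Subsingleton (Ext Q (D.gamma a : A) 1) := by
  have := (D.isHull a).injective
  have : Subsingleton (Ext Q (D.hull a) 1) := Ext.subsingleton_of_injective _ _ 0
  exact subsingleton_ext_one_left (shortExact_cokernel (D.gamma a).arrow) Q
    (D.hom_cokernel_eq_zero hQ)

lemma subsingleton_ext_gr {a b : Λ} (hab : P.le a b) {I : A} {F : ℕ →o Subobject I} {n : ℕ}
    (e : gr F n ≅ (D.gamma b : A)) {Q : A} (hQ : FactorsIn L {b | P.le b a} Q) :
    Subsingleton (Ext Q (gr F n) 1) := by
  have := D.subsingleton_ext_gamma (a := b) (hQ.subset fun c hc => P.le_trans _ _ _ hc hab)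
  exact subsingleton_ext_of_iso e.symm

/-- `F j / F 1` is an iterated extension of objects `gamma b` with a ≤ b, and each has no Ext¹ from
objects with factors ≤ a ≤ b. -/
lemma subsingleton_ext_flag {a : Λ} {I : A} {F : ℕ →o Subobject I} {n : ℕ}
    (hF : ∀ j < n, ∃ b, P.le a b ∧ Nonempty (gr F j ≅ (D.gamma b : A))) {Q : A}
    (hQ : FactorsIn L {b | P.le b a} Q) (j : ℕ) (hj : 1 ≤ j) (hjn : j ≤ n) :
    Subsingleton (Ext Q (cokernel (Subobject.ofLE _ _ (F.monotone hj))) 1) := by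
  induction j, hj using Nat.le_induction with
  | base =>
    have : Epi (Subobject.ofLE (F 1) (F 1) le_rfl) := by
      rw [Subobject.ofLE_refl]; infer_instance
    have h0 : IsZero (cokernel (Subobject.ofLE (F 1) (F 1) le_rfl)) :=
      isZero_cokernel_of_epi _
    have := h0.injective
    exact Ext.subsingleton_of_injective _ _ 0
  | succ j hj ih =>
    have := ih (by omega)
    obtain ⟨b, hb, ⟨e⟩⟩ := hF j (by omega)
    have := D.subsingleton_ext_gr hb e hQ
    obtain ⟨α, β, w, h, -, -⟩ := shortExact_cokernel_comp
      (shortExact_cokernel (Subobject.ofLE _ _ (F.monotone hj))).exact (shortExact_gr F j)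
    have h1 := subsingleton_ext_one_middle h Q
    rw [Subobject.ofLE_comp_ofLE] at h1
    exact h1

/-- The first step of a flag of a subobject of `hull a` is `gamma a`. -/
lemma gamma_eq_of_flag {a : Λ} {F : ℕ →o Subobject (D.hull a)} (h0 : F 0 = ⊥) {b : Λ}
    (e : gr F 0 ≅ (D.gamma b : A)) : F 1 = D.gamma a := by
  have := D.labels.simple a
  have : IsIso (grπ F 0) := isIso_grπ_zero h0
  let e' : (F 1 : A) ≅ (D.gamma b : A) := asIso (grπ F 0) ≪≫ e
  obtain ⟨l, _, -⟩ := D.exists_mono_gamma b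
  obtain rfl := D.labels.eq_of_mono_hull (D.isHull a) (l ≫ e'.inv ≫ (F 1).arrow)
  have hF1 : FactorsIn L {c | P.le c b} (F 1 : A) := FactorsIn.of_mono e'.hom (D.isGamma b).1
  have hle : F 1 ≤ D.gamma b := (D.isGamma b).2 hF1
  set θ := Subobject.ofLE _ _ hle with hθ
  have hθ' : θ ≫ (D.gamma b).arrow = (F 1).arrow := Subobject.ofLE_arrow _
  -- Now `b` is the label of the hull, and `F 1 ⊆ gamma b` is abstractly isomorphic to `gamma b`.
  -- The Ext vanishing splits this inclusion; since the socle is simple and lies in `F 1`, the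
  -- retraction `ρ` has zero kernel.
  have := D.subsingleton_ext_gamma ((D.isGamma b).1.of_epi (cokernel.π θ))
  have : Subsingleton (Ext (cokernel θ) (F 1 : A) 1) := subsingleton_ext_of_iso e'.symm
  obtain ⟨ρ, hρ⟩ := exists_extension_of_subsingleton_ext (shortExact_cokernel θ) (𝟙 (F 1 : A))
  have : Mono ρ := by
    apply Preadditive.mono_of_kernel_zero
    by_contra hk
    have hk' : ¬ IsZero (kernel ρ) := fun hz => hk (hz.eq_of_src _ _)
    obtain ⟨l₁, _, hl₁⟩ := (D.isHull b).exists_lift (kernel.ι ρ ≫ (D.gamma b).arrow) hk'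
    obtain ⟨l₂, _, hl₂⟩ := (D.isHull b).exists_lift (F 1).arrow
      (fun hz => D.not_isZero_gamma b (hz.of_iso e'.symm))
    have h1 : l₁ ≫ kernel.ι ρ = l₂ ≫ θ := by
      rw [← cancel_mono (D.gamma b).arrow, Category.assoc, Category.assoc, hl₁, hθ', hl₂]
    have h2 : l₂ = 0 := by
      rw [← Category.comp_id l₂, ← hρ, ← Category.assoc, ← h1]; simp
    exact D.labels.ne_zero b l₂ h2
  refine le_antisymm hle (Subobject.le_of_comm ρ ?_)
  have h1 : ρ ≫ θ = 𝟙 _ := by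
    rw [← cancel_mono ρ, Category.assoc, hρ]; simp
  rw [← hθ', ← Category.assoc, h1, Category.id_comp]

/-- Morphisms from simple objects to `hull a / gamma a` extend along monomorphisms whose cokernel
has all its composition factors below `a`. -/
lemma exists_extension {a c : Λ} (s : L c ⟶ cokernel (D.gamma a).arrow) [Mono s] {Y Q : A}
    {i : L c ⟶ Y} {q : Y ⟶ Q} {w : i ≫ q = 0} (h : (ShortComplex.mk i q w).ShortExact)
    (hQ : FactorsIn L {b | P.le b a} Q) :
    ∃ y : Y ⟶ cokernel (D.gamma a).arrow, i ≫ y = s := by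
  have := D.labels.simple c
  obtain ⟨X, x, p, -, _, hX, _, -, -, hxp, -⟩ :=
    D.locallyArtinian.exists_coessential_cokernel (D.gamma a).arrow s
  obtain ⟨𝒮, hne, hdir, hlub, hflag⟩ := D.exists_flags a
  have : IsNoetherianObject (Subobject.mk x : A) :=
    (hX.of_mono (Subobject.underlyingIso x).hom).2
  -- The finite length cover `X` of `L c` lies in a single flagged subobject `Z`. Hence `s` factors
  -- through `Z / gamma a`, where the extension problem is unobstructed.
  obtain ⟨Z, hZ, hxZ⟩ := D.locallyArtinian.exists_le hne hdir hlub (Subobject.mk x)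
  obtain ⟨n, F, hF0, rfl, hF⟩ := hflag Z hZ
  have hn : 1 ≤ n := by
    by_contra hn
    obtain rfl : n = 0 := by omega
    have hx0 : x = 0 := by
      rw [← Subobject.ofMkLE_arrow hxZ, (isZero_of_eq_bot hF0).eq_of_tgt
        (Subobject.ofMkLE x (F 0) hxZ) 0, zero_comp]
    have hXz := IsZero.of_mono_eq_zero x hx0
    exact Simple.not_isZero (L c) (IsZero.of_epi_eq_zero p (hXz.eq_of_src _ _))
  obtain ⟨b, -, ⟨e⟩⟩ := hF 0 (by omega)
  have hγ := D.gamma_eq_of_flag hF0 e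
  generalize D.gamma a = W at s hxp hγ ⊢
  subst hγ
  have := D.subsingleton_ext_flag hF hQ n hn le_rfl
  have hses := shortExact_cokernel_comp
    (shortExact_cokernel (Subobject.ofLE _ _ (F.monotone hn))).exact
    (shortExact_cokernel (F n).arrow)
  rw [Subobject.ofLE_arrow] at hses
  obtain ⟨α, β, _, hα, hα', -⟩ := hses
  have : Mono α := hα.mono_f
  set x' := Subobject.ofMkLE x (F n) hxZ ≫ cokernel.π (Subobject.ofLE _ _ (F.monotone hn))
    with hx'
  have h1 : x' ≫ α = p ≫ s := by
    rw [hx', Category.assoc, hα', ← Category.assoc, Subobject.ofMkLE_arrow, hxp]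
  have h2 : kernel.ι p ≫ x' = 0 := by
    rw [← cancel_mono α, Category.assoc, h1, kernel.condition_assoc, zero_comp, zero_comp]
  have h3 : Abelian.epiDesc p x' h2 ≫ α = s := by
    rw [← cancel_epi p, ← Category.assoc, Abelian.comp_epiDesc, h1]
  obtain ⟨y, hy⟩ := exists_extension_of_subsingleton_ext h (Abelian.epiDesc p x' h2)
  exact ⟨y ≫ α, by rw [← Category.assoc, hy, h3]⟩

end FlaggedHulls

end Flags

/-! ### Part II: comparison of the two kinds of costandard objects -/

section Comparison

variable {A : Type u} [Category.{v} A] [Abelian A] {Λ : Type x} {L : Λ → A}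
  {k : Type t} [Field k] [Linear k A] {P Q : PartialOrder Λ}

namespace CPSHighestWeight

variable (K : CPSHighestWeight k L Q)

/-- The comparison of the costandard objects, for a label `a` such that no simple subobject of
`hull a / cost a` has a label below `a`. -/
lemma nonempty_iso_gamma [HasExt.{w'} A] (D : FlaggedHulls L P) (hdual : HasDuals L) {a : Λ}
    (ha : ∀ X, FactorsIn L {b | P.le b a} X → ∀ f : X ⟶ cokernel (K.costHull a), f = 0) :
    Nonempty ((D.gamma a : A) ≅ K.cost a) := by
  have := K.labels.simple a
  have := K.emb_mono a
  obtain ⟨φ⟩ := (D.isHull a).nonempty_iso (K.isHull a)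
  have hd : ((D.gamma a).arrow ≫ φ.hom) ≫ cokernel.π (K.costHull a) = 0 :=
    ha _ (D.isGamma a).1 _
  obtain ⟨e, he⟩ : ∃ e : (D.gamma a : A) ⟶ K.cost a,
      e ≫ K.costHull a = (D.gamma a).arrow ≫ φ.hom := ⟨_, Abelian.monoLift_comp _ _ hd⟩
  have : Mono e := mono_of_mono_fac he
  have hej : (D.gamma a).arrow = e ≫ K.costHull a ≫ φ.inv := by
    rw [← Category.assoc, he]; simp
  by_contra hne
  have hcok : ¬ IsZero (cokernel e) := fun hz => by
    have := isIso_of_isZero_cokernel e hz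
    exact hne ⟨asIso e⟩
  -- The socle `L a` of the hull already lies in `gamma a`. Thus `cost a / gamma a` is a quotient of
  -- `cost a / L a`, and its factors have labels strictly below `a` for `Q`.
  have hemb : K.emb a ≫ cokernel.π e = 0 := by
    obtain ⟨l, -, hl⟩ := (K.isHull a).exists_lift_of_mono (K.emb a ≫ K.costHull a)
      (e ≫ K.costHull a) (D.not_isZero_gamma a)
    have h1 : l ≫ e = K.emb a := by
      rw [← cancel_mono (K.costHull a), Category.assoc, hl]
    rw [← h1, Category.assoc, cokernel.condition, comp_zero]
  have : Epi (cokernel.desc (K.emb a) (cokernel.π e) hemb) :=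
    epi_of_epi_fac (cokernel.π_desc (K.emb a) (cokernel.π e) hemb)
  have hlt : ∀ c, IsFactor (L c) (cokernel e) → Q.lt c a := fun c hc =>
    K.lt_of_factor a c (hc.of_epi (cokernel.desc (K.emb a) (cokernel.π e) hemb))
  obtain ⟨m, s, _⟩ := K.locallyArtinian.exists_simple K.labels hcok
  have := K.labels.simple m
  have hma := lt_ne (hlt m (isFactor_of_mono s))
  obtain ⟨X, x, p, r, _, hX, _, hp, _, -, -⟩ :=
    K.locallyArtinian.exists_coessential_cokernel e s
  have hR : ¬ IsZero (kernel p) := by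
    intro hz
    have : Mono p := Preadditive.mono_of_isZero_kernel _ hz
    have : IsIso p := isIso_of_mono_of_epi p
    exact hma (K.eq_of_mono_cost (inv p ≫ x))
  obtain ⟨l, _, -⟩ := (K.isHull a).exists_lift (r ≫ e ≫ K.costHull a) hR
  -- The dual `U` of `X` has socle `L m`, and `U / L m` has the factors of the radical of `X`, all ≤
  -- a and with `L a` among them.
  obtain ⟨U, hU, -⟩ := hdual (𝟙 X) hX inferInstance
  obtain ⟨V, i, q, w, hiq, hi, hV⟩ := hU _ _ _ (shortExact_kernel p) hp
  have : Epi q := hiq.epi_g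
  obtain ⟨α, β, w', hαβ, -, -⟩ := shortExact_cokernel_comp (shortExact_cokernel e).exact
    (shortExact_cokernel (K.costHull a ≫ φ.inv))
  have : Mono α := hαβ.mono_f
  have hVa : FactorsIn L {b | P.le b a} V := fun c hc =>
    FactorsIn.of_mono r (D.isGamma a).1 c ((hV c).1 hc)
  obtain ⟨y, hy⟩ : ∃ y : U ⟶ cokernel (e ≫ K.costHull a ≫ φ.inv), i ≫ y = s ≫ α := by
    have h := fun (s : L m ⟶ cokernel (D.gamma a).arrow) (_ : Mono s) =>
      D.exists_extension s hiq hVa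
    rw [hej] at h
    exact h (s ≫ α) inferInstance
  have hyβ : i ≫ y ≫ β = 0 := by
    rw [← Category.assoc, hy, Category.assoc, w', comp_zero]
  obtain ⟨z, hz⟩ : ∃ z : V ⟶ cokernel (K.costHull a ≫ φ.inv), q ≫ z = y ≫ β :=
    ⟨hiq.exact.desc _ hyβ, hiq.exact.g_desc _ hyβ⟩
  -- Modulo `cost a`, the map `y` factors through `V`, whose factors are ≤ a, so `ha` forces `y` to
  -- land in `cost a / gamma a`.
  have hz0 : z = 0 := by
    let ψ : cokernel (K.costHull a ≫ φ.inv) ≅ cokernel (K.costHull a) :=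
      cokernel.mapIso _ _ (Iso.refl _) φ (by simp)
    rw [← cancel_mono ψ.hom, zero_comp]
    exact ha _ hVa _
  rw [hz0, comp_zero] at hz
  obtain ⟨y', hy'⟩ : ∃ y' : U ⟶ cokernel e, y' ≫ α = y :=
    ⟨hαβ.exact.lift _ hz.symm, hαβ.exact.lift_f _ hz.symm⟩
  have hiy : i ≫ y' = s := by
    rw [← cancel_mono α, Category.assoc, hy', hy]
  have : Mono y' := hi y' (by rw [hiy]; infer_instance)
  exact lt_irrefl a (hlt a ((((hV a).2 (isFactor_of_mono l)).of_epi q).of_mono y'))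

/-- The dual `U` of the given object has socle `L a` and a quotient `L c`, so it embeds in `hull a`.
The kernel of `U ⟶ L c` lies in `cost a` by `ha`, but `U` itself does not, since `L c` is not a
factor of `cost a`. Hence `L c` embeds in `hull a / cost a`. -/
lemma extensionsAbove_of_hasDuals (hdual : HasDuals L) {Ω : Set Λ} {a : Λ}
    (ha : ∀ X, FactorsIn L (insert a Ω) X → ∀ f : X ⟶ cokernel (K.costHull a), f = 0)
    (hcost : FactorsIn L (insert a Ω) (K.cost a)) : ExtensionsAbove L Q Ω a := by
  intro c X₀ X R e r p w s hX₀ he hrp hp _ _ hs hc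
  have := K.labels.simple c
  have : Mono r := hrp.mono_f
  obtain ⟨U, h1, h2⟩ := hdual e hX₀ he
  obtain ⟨V₁, i, q, w₁, hiq, hi, -⟩ := h1 r p w hrp hp
  obtain ⟨V, j, π, w₂, hjπ, hV⟩ := h2 _ _ _ (shortExact_cokernel (s ≫ r))
  have : Epi π := hjπ.epi_g
  have hVa : FactorsIn L (insert a Ω) V := by
    obtain ⟨α, β, w', hαβ, -, -⟩ := shortExact_cokernel_comp (shortExact_cokernel s).exact hrp
    have : Mono α := hαβ.mono_f
    have h3 : FactorsIn L (insert a Ω) (cokernel (s ≫ r)) :=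
      FactorsIn.of_exact K.labels hαβ.exact (hs.subset (Set.subset_insert a Ω))
        (factorsIn_simple K.labels (Set.mem_insert a Ω))
    exact fun d hd => h3 d ((hV d).1 hd)
  have := (K.isHull a).injective
  have := (K.isHull a).mono
  have : Mono i := hiq.mono_f
  let u : U ⟶ K.hull a := Injective.factorThru (K.hullEmb a) i
  have hu : i ≫ u = K.hullEmb a := Injective.comp_factorThru _ _
  have : Mono u := hi u (by rw [hu]; infer_instance)
  have hj : j ≫ u ≫ cokernel.π (K.costHull a) = 0 := ha V hVa _
  obtain ⟨z, hz⟩ : ∃ z : L c ⟶ cokernel (K.costHull a), π ≫ z = u ≫ cokernel.π (K.costHull a) :=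
    ⟨hjπ.exact.desc _ hj, hjπ.exact.g_desc _ hj⟩
  have hz0 : z ≠ 0 := by
    intro h0
    rw [h0, comp_zero] at hz
    have h3 := Abelian.monoLift_comp _ _ hz.symm
    have : Mono (Abelian.monoLift (K.costHull a) u hz.symm) := mono_of_mono_fac h3
    exact hc (hcost c ((isFactor_of_epi π).of_mono (Abelian.monoLift (K.costHull a) u hz.symm)))
  have := K.labels.mono_of_ne_zero hz0
  exact (K.lt_of_mono_cokernel_costHull z).1

/-- The three assertions are proved together by induction on the number of labels ≤ a. The third one
below `a` gives the first at `a`; that yields the second, and both feed `mem_of_section` with Ω = {b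
< a} to give the third. -/
lemma comparison [HasExt.{w'} A] (D : FlaggedHulls L P) (hdual : HasDuals L)
    (hP : ∀ a, {b | P.le b a}.Finite) (a : Λ) :
    (∀ X, FactorsIn L {b | P.le b a} X → ∀ f : X ⟶ cokernel (K.costHull a), f = 0) ∧
    Nonempty ((D.gamma a : A) ≅ K.cost a) ∧
    ∀ b (F : ℕ →o Subobject (K.hull b)), IsGoodFiltration Q K.cost b F →
      ∀ n, Nonempty (gr F n ≅ K.cost a) → P.le b a := by
  have hins : ∀ a, insert a {b | P.lt b a} = {b | P.le b a} := fun a => by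
    let := P
    exact Set.Iio_insert
  induction h : {b | P.le b a}.ncard using Nat.strong_induction_on generalizing a with
  | _ N ih =>
    subst h
    have ih' : ∀ c, P.lt c a → _ := fun c hc => ih _ (Set.ncard_lt_ncard (by
      let := P
      exact Set.Iic_ssubset_Iic.2 hc) (hP a)) c rfl
    have h₀ : ∀ X, FactorsIn L {b | P.le b a} X → ∀ f : X ⟶ cokernel (K.costHull a), f = 0 := by
      intro X hX f
      refine K.eq_zero_of_forall hX (fun b hb s hs => ?_) f
      obtain ⟨hab, n, hn⟩ := K.lt_of_mono_cokernel_costHull s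
      have hne := lt_ne hab
      have hba : P.lt b a := by
        let := P
        exact lt_of_le_of_ne hb hne.symm
      -- `cost b` is a section of `hull a` with b < a, so the induction hypothesis at `b` gives a ≤
      -- b.
      have := (ih' b hba).2.2 a _ (K.good a) n hn
      exact hne (P.le_antisymm _ _ this hb)
    obtain ⟨φ⟩ := K.nonempty_iso_gamma D hdual h₀
    have hcost : FactorsIn L {b | P.le b a} (K.cost a) := FactorsIn.of_epi φ.hom (D.isGamma a).1
    refine ⟨h₀, ⟨φ⟩, fun b F hF n ⟨e⟩ => ?_⟩
    have := K.mem_of_section (Ω := {b | P.lt b a}) (a := a) ?_ ?_ ?_ hF e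
    · rwa [hins] at this
    · rintro c (rfl | hc)
      · rwa [hins]
      · obtain ⟨ψ⟩ := (ih' c hc).2.1
        rw [hins]
        exact (FactorsIn.of_epi ψ.hom (D.isGamma c).1).subset fun d hd =>
          P.le_trans _ _ _ hd ((P.lt_iff_le_not_ge _ _).1 hc).1
    · intro c hc b n hn
      rw [hins]
      exact P.le_trans _ _ _ ((ih' c hc).2.2 b _ (K.good b) n hn)
        ((P.lt_iff_le_not_ge _ _).1 hc).1
    · refine K.extensionsAbove_of_hasDuals hdual ?_ ?_
      · rwa [hins]
      · rwa [hins]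

lemma isGamma_filt {a : Λ} {Ω : Set Λ}
    (ha : ∀ X, FactorsIn L Ω X → ∀ f : X ⟶ cokernel (K.costHull a), f = 0)
    (hcost : FactorsIn L Ω (K.cost a)) : IsGamma L Ω (K.filt a 1) := by
  refine ⟨FactorsIn.of_mono (K.good a).one.some.hom hcost, fun Y hY => ?_⟩
  have h1 := Abelian.monoLift_comp (K.costHull a) Y.arrow (ha _ hY _)
  rw [← K.mk_costHull a]
  exact Subobject.le_mk_of_comm _ h1

end CPSHighestWeight

lemma HasFlag.of_iso {c c' : Λ → A} (e : ∀ b, c b ≅ c' b) {a : Λ} {I : A} {Y : Subobject I}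
    (h : HasFlag P c a Y) : HasFlag P c' a Y := by
  obtain ⟨n, F, h0, hn, hF⟩ := h
  refine ⟨n, F, h0, hn, fun j hj => ?_⟩
  obtain ⟨b, hb, ⟨f⟩⟩ := hF j hj
  exact ⟨b, hb, ⟨f ≪≫ e b⟩⟩

end Comparison

end HW

end

theorem mainTheorem7 (k : Type t) [Field k] :
    (∀ (A : Type u') [Category.{v'} A] [Abelian A] [Linear k A] [HasExt.{w'} A]
        (Λ : Type y) (L : Λ → A) (P : PartialOrder Λ) (H : HW.CPSHighestWeight k L P) (a : Λ),
        (∀ b, Module.rank k (Abelian.Ext (L a) (L b) 1) =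
          Module.rank k (Abelian.Ext (L b) (L a) 1)) →
        (Subsingleton (Abelian.Ext (L a) (L a) 2) → IsIso (H.emb a)) ∧
        (IsIso (H.emb a) → ∀ (b : Λ) (F : ℕ →o Subobject (H.hull b)),
          HW.IsGoodFiltration P H.cost b F →
            ((∃ n, Nonempty (HW.gr F n ≅ H.cost a)) ↔ b = a))) ∧
    (IsAlgClosed k →
      ∀ (C : Type u) [Category.{v} C] [Abelian C] [Linear k C] [EssentiallySmall.{w} C],
        HW.IsFiniteLengthCategory k C →
        ∀ (Λ : Type x) (L : Λ → C) (P : PartialOrder Λ)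
          (H : HW.LowerFiniteHighestWeight.{w} L P)
          (Ψ : Cᵒᵖ ≌ C), (∀ S : C, Simple S → Nonempty (Ψ.functor.obj (Opposite.op S) ≅ S)) →
        ∀ (Q : PartialOrder Λ)
          (K : HW.CPSHighestWeight k (fun a => (HW.toInd.{w} C).obj (L a)) Q) (a : Λ),
          Nonempty (K.cost a ≅ (HW.toInd.{w} C).obj (H.cost a)) ∧
          HW.IsGamma (fun b => (HW.toInd.{w} C).obj (L b)) {b | P.le b a} (K.filt a 1)) := by
  constructor
  · intro A _ _ _ _ Λ L P H a h
    have h' : ∀ b, Subsingleton (Abelian.Ext (L a) (L b) 1) ↔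
        Subsingleton (Abelian.Ext (L b) (L a) 1) := fun b => by
      rw [← rank_zero_iff (R := k), h b, rank_zero_iff]
    exact ⟨H.isIso_emb_of_subsingleton_ext fun b => (h' b).1,
      fun ha b F hF => H.section_iff_of_isIso_emb ha (fun b => (h' b).2) hF⟩
  · intro _ C _ _ _ _ hC Λ L P H Ψ hΨ Q K a
    -- Ext groups do not occur in this half of the statement, so any model of them may be chosen.
    let := HasExt.standard (HW.IndCompletion.{w} C)
    have := H.costEmb_mono
    let D : HW.FlaggedHulls (fun a => (HW.toInd.{w} C).obj (L a)) P :=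
      { labels := K.labels
        locallyArtinian := K.locallyArtinian
        hull := H.hull
        hullEmb := H.hullEmb
        isHull := H.isHull
        gamma := fun a => Subobject.mk (H.costEmb a)
        isGamma := H.isGamma
        exists_flags := fun a => by
          obtain ⟨𝒮, h1, h2, h3, h4⟩ := H.exists_flags a
          exact ⟨𝒮, h1, h2, h3, fun Y hY =>
            (h4 Y hY).of_iso fun b => (Subobject.underlyingIso (H.costEmb b)).symm⟩ }
    have hdual := HW.hasDuals (HW.separating_toInd.{w} C) (fun X => (hC.finiteLength X).2) Ψ
      (fun a => hΨ _ (H.labels.simple a))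
    obtain ⟨h0, ⟨φ⟩, -⟩ := K.comparison D hdual H.lower_finite a
    exact ⟨⟨φ.symm ≪≫ Subobject.underlyingIso (H.costEmb a)⟩,
      K.isGamma_filt h0 (HW.FactorsIn.of_epi φ.hom (D.isGamma a).1)⟩
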